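/- A cubic graph here may have half-edges (edges incident with exactly one vertex) and parallel edges; every vertex is incident with exactly three edges, half-edges included. The line graph $L(G)$ has all edges and half-edges of $G$ as vertices, two distinct ones being adjacent if they are incident with a common vertex. For a 3-colorable graph $X$, the 3-coloring complex $B(X)$ is the graph whose vertices are the color classes of all 3-colorings of $X$, two distinct classes being adjacent if they appear together in some 3-coloring of $X$. The graph $X$ is reflexive if $\phi_X : v \mapsto \{C \in V(B(X)) : v \in C\}$ is a graph isomorphism from $X$ to $B(B(X))$. A graph $G$ is edge-reflexive if $L(G)$ is 3-colorable and reflexive. For $k,l,m\ge 1$, the cubic theta graph $T_{k,l,m}$ is obtained from three paths of lengths $k$, $l$, $m$ by identifying their first vertices, identifying their last vertices, and adding one half-edge at every inner vertex of each path. Up to isomorphism it does not depend on the order of $k,l,m$. **Theorem.** The cubic theta graphs $T_{1,1,m}$ $(m\ge 2)$, $T_{1,2,m}$ $(m\ge 1)$, $T_{2,2,2}$, $T_{2,2,3}$, $T_{2,2,4}$, $T_{2,3,3}$, $T_{2,3,4}$ and $T_{3,3,3}$ (the parameters being taken in any order) are not edge-reflexive. All other cubic theta graphs, i.e. all other $T_{k,l,m}$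 with $k,l,m\ge 1$, are edge-reflexive. -/

import Mathlib

/-- The `k`-coloring complex `B(X)` of a graph `X`. Its vertices are the color classes of all
`k`-colorings of `X`; two different color classes are adjacent if they appear together in a
`k`-coloring of `X`. -/
def coloringComplex {V : Type*} (k : ℕ) (X : SimpleGraph V) :
    SimpleGraph {S : Set V // ∃ (c : X.Coloring (Fin k)) (i : Fin k), c.colorClass i = S} where
  Adj S T := S ≠ T ∧
    ∃ (c : X.Coloring (Fin k)) (i j : Fin k), c.colorClass i = S.1 ∧ c.colorClass j = T.1
  symm := ⟨fun _ _ ⟨hne, c, i, j, hi, hj⟩ => ⟨hne.symm, c, j, i, hj, hi⟩⟩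
  loopless := ⟨fun _ h => h.1 rfl⟩

/-- A `k`-colorable graph `X` is reflexive (for `k`-colorings) if the canonical map, which sends a
vertex `v` of `X` to the set of all color classes of `X` that contain `v`, is an isomorphism from
`X` to `B(B(X))`. -/
def IsReflexiveGraph {V : Type*} (k : ℕ) (X : SimpleGraph V) : Prop :=
  X.Colorable k ∧
    ∃ f : X ≃g coloringComplex k (coloringComplex k X), ∀ v : V, (f v).1 = {C | v ∈ C.1}

/-- A graph in which parallel edges and half-edges are allowed (and loops are not), with vertex
set `V` and edge set `E`. Every edge is incident with two vertices (a full edge) or with exactly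
one vertex (a half-edge). -/
structure HalfEdgeGraph (V E : Type*) where
  /-- The set of vertices incident with an edge. -/
  ends : E → Set V
  ncard_ends : ∀ e, (ends e).ncard = 1 ∨ (ends e).ncard = 2

namespace HalfEdgeGraph

variable {V E : Type*}

/-- The line graph: its vertices are all edges, including the half-edges, and two different
edges are adjacent if they are incident with a common vertex. -/
def lineGraph (G : HalfEdgeGraph V E) : SimpleGraph E where
  Adj e f := e ≠ f ∧ ∃ v, v ∈ G.ends e ∧ v ∈ G.ends f
  symm := ⟨fun _ _ ⟨hne, v, he, hf⟩ => ⟨hne.symm, v, hf, he⟩⟩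
  loopless := ⟨fun _ h => h.1 rfl⟩

/-- `G` is edge-reflexive if it is 3-edge-colorable and its line graph is reflexive
for 3-colorings. -/
def EdgeReflexive (G : HalfEdgeGraph V E) : Prop :=
  IsReflexiveGraph 3 G.lineGraph

end HalfEdgeGraph

/-- The vertices of the theta graph made of three paths of lengths `n 0`, `n 1`, `n 2`: the
common first vertex, the common last vertex, and the `n i - 1` inner vertices of each path. -/
inductive ThetaVertex (n : Fin 3 → ℕ) : Type
  | first : ThetaVertex n
  | last : ThetaVertex n
  | inner (i : Fin 3) (j : Fin (n i - 1)) : ThetaVertex n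

/-- The edges of the cubic theta graph: the `n i` edges of each path, and one half-edge for each
inner vertex (the inner vertices have degree two on the three paths, while the common end
vertices have degree three already). -/
inductive ThetaEdge (n : Fin 3 → ℕ) : Type
  | path (i : Fin 3) (j : Fin (n i)) : ThetaEdge n
  | half (i : Fin 3) (j : Fin (n i - 1)) : ThetaEdge n

/-- The `j`-th vertex of the `i`-th path, `0 ≤ j ≤ n i`. -/
def thetaPathVertex (n : Fin 3 → ℕ) (i : Fin 3) (j : ℕ) : ThetaVertex n :=
  if j = 0 then .first
  else if h : j - 1 < n i - 1 then .inner i ⟨j - 1, h⟩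
  else .last

/-- The vertices incident with an edge of the cubic theta graph. -/
def thetaEnds (n : Fin 3 → ℕ) : ThetaEdge n → Set (ThetaVertex n)
  | .path i j => {thetaPathVertex n i j, thetaPathVertex n i (j + 1)}
  | .half i j => {.inner i j}

theorem thetaPathVertex_ne (n : Fin 3 → ℕ) (i : Fin 3) (j : Fin (n i)) :
    thetaPathVertex n i j ≠ thetaPathVertex n i (j + 1) := by
  have hj := j.2
  unfold thetaPathVertex
  split_ifs <;> simp <;> omega

/-- The cubic theta graph `T_{k,l,m}`, for `k, l, m ≥ 1`. -/
def thetaGraph (k l m : ℕ) : HalfEdgeGraph (ThetaVertex ![k, l, m]) (ThetaEdge ![k, l, m]) where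
  ends := thetaEnds ![k, l, m]
  ncard_ends e := by
    cases e with
    | path i j => exact Or.inr (Set.ncard_pair (thetaPathVertex_ne _ i j))
    | half i j => exact Or.inl (Set.ncard_singleton _)

/-! A 3-edge-coloring is determined by its colors on the three paths, since a half-edge takes the
color missing at its vertex. A 3-coloring of the coloring complex therefore amounts to a labelling
`F` of the three classes of every coloring, bijective for each coloring and depending only on the
class (`Virtual`). Every vertex of the graph yields such a labelling: a class is labelled by the one
edge at the vertex that it contains. Edge-reflexivity splits into two conditions: any two edges
differ in color somewhere (`Separated`, which is injectivity of the canonical map), and every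
labelling comes from a vertex (`VerticesOnly`, which gives surjectivity and the adjacencies).

In the two infinite exceptional families, two edges are forced to have equal colors. In the six
remaining exceptions a finite search finds a labelling that belongs to no vertex.

The positive cases are proved by induction on the length of a path, starting from finitely many
searches. Inserting the third color between the edges `p` and `p + 1` of a path embeds the colorings
of the shorter graph into those of the longer one; the image consists of the colorings whose new
edges `p` and `p + 2` differ. On the image for each `p = 0, 1, 2`, a labelling of the longer graph
comes from some vertex, by induction. Colorings that begin with `x, y, z, x, y` lie in all three
images and correspond to colorings of the graph with the path shorter by three; `Separated` for that
graph shows that the three vertices coincide or all lie among the first four inner vertices of the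
path. Colorings that lie in two images exclude enough combinations to leave one vertex that serves
all three images (`VerticesOnly.grow`). Outside the images a coloring begins with `x, y, x, y, x`,
and its classes of `x` and `y` also occur in colorings inside an image (`Virtual.realOn_univ`). -/

namespace CubicTheta

/-! ### Path colorings and labellings of their classes -/

/-- Colors of the edges of three paths; the values beyond the lengths of the paths are ignored. -/
abbrev PathColoring := Fin 3 → ℕ → Fin 3

/-- The color different from two different given colors. -/
def third (x y : Fin 3) : Fin 3 := -(x + y)

theorem third_ne_left {x y : Fin 3} (h : x ≠ y) : third x y ≠ x := by
  revert x y; decide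

theorem third_ne_right {x y : Fin 3} (h : x ≠ y) : third x y ≠ y := by
  revert x y; decide

theorem third_comm (x y : Fin 3) : third x y = third y x := by
  simp [third, add_comm]

theorem eq_third {x y z : Fin 3} (h : x ≠ y) (hx : z ≠ x) (hy : z ≠ y) : z = third x y := by
  revert x y z; decide

theorem third_eq_iff {x y z : Fin 3} (h : x ≠ y) : third x y = z ↔ x ≠ z ∧ y ≠ z := by
  revert x y z; decide

/-- This is linear algebra over the integers mod 3, so the colors need not be different. -/
theorem third_third_left {x y : Fin 3} : third (third x y) x = y := by
  revert x y; decide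

theorem third_third_right {x y : Fin 3} : third x (third x y) = y := by
  revert x y; decide

/-- `a` restricts to a proper coloring of the three paths with the colors at the two common ends
pairwise different; it has a unique extension to the half-edges. -/
structure Valid (n : Fin 3 → ℕ) (a : PathColoring) : Prop where
  step : ∀ i j, j + 1 < n i → a i j ≠ a i (j + 1)
  first : Function.Injective fun i => a i 0
  last : Function.Injective fun i => a i (n i - 1)

/-- Edges of the cubic theta graphs, with indices in `ℕ`. -/
inductive Edge : Type
  | path (i : Fin 3) (j : ℕ) : Edge
  | half (i : Fin 3) (j : ℕ) : Edge
  deriving DecidableEq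

/-- Vertices of the cubic theta graphs, with indices in `ℕ`. -/
inductive Vertex : Type
  | first : Vertex
  | last : Vertex
  | inner (i : Fin 3) (j : ℕ) : Vertex
  deriving DecidableEq

/-- The edge belongs to the theta graph with path lengths `n`. -/
def Edge.Mem (n : Fin 3 → ℕ) : Edge → Prop
  | .path i j => j < n i
  | .half i j => j + 1 < n i

/-- The vertex belongs to the theta graph with path lengths `n`. -/
def Vertex.Mem (n : Fin 3 → ℕ) : Vertex → Prop
  | .first => True
  | .last => True
  | .inner i j => j + 1 < n i

/-- The color of an edge. -/
def color (a : PathColoring) : Edge → Fin 3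
  | .path i j => a i j
  | .half i j => third (a i j) (a i (j + 1))

/-- The three edges at a vertex. -/
def star (n : Fin 3 → ℕ) : Vertex → Fin 3 → Edge
  | .first => fun s => .path s 0
  | .last => fun s => .path s (n s - 1)
  | .inner i j => ![.path i j, .path i (j + 1), .half i j]

theorem star_mem {n : Fin 3 → ℕ} (hn : ∀ i, 1 ≤ n i) {w : Vertex} (hw : w.Mem n) (s : Fin 3) :
    (star n w s).Mem n := by
  cases w with
  | first => exact hn s
  | last => have := hn s; simp only [star, Edge.Mem]; omega
  | inner i j =>
    simp only [Vertex.Mem] at hw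
    fin_cases s <;> simp [star, Edge.Mem] <;> omega

theorem Valid.color_star_injective {n : Fin 3 → ℕ} {a : PathColoring} (ha : Valid n a)
    {w : Vertex} (hw : w.Mem n) : Function.Injective fun s => color a (star n w s) := by
  cases w with
  | first => exact ha.first
  | last => exact ha.last
  | inner i j =>
    have h := ha.step i j hw
    have h1 := third_ne_left h
    have h2 := third_ne_right h
    intro s s' hs
    fin_cases s <;> fin_cases s' <;> simp_all [star, color, eq_comm]

/-- `F a t` is the color of the color class `t` of `a` in a 3-coloring of the coloring complex. -/
structure Virtual (n : Fin 3 → ℕ) (F : PathColoring → Fin 3 → Fin 3) : Prop where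
  injective : ∀ a, Valid n a → Function.Injective (F a)
  local_eq : ∀ a a', Valid n a → Valid n a' → ∀ t t',
    (∀ i j, j < n i → (a i j = t ↔ a' i j = t')) → F a t = F a' t'

/-- The 3-coloring `F` of the coloring complex is, on the colorings in `D`, given by the edges
at the vertex `w`. -/
def RealOn (n : Fin 3 → ℕ) (D : Set PathColoring) (F : PathColoring → Fin 3 → Fin 3)
    (w : Vertex) : Prop :=
  ∃ τ : Fin 3 → Fin 3, ∀ s, ∀ a ∈ D, Valid n a → F a (color a (star n w s)) = τ s

/-- Every 3-coloring of the coloring complex comes from a vertex. -/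
def VerticesOnly (n : Fin 3 → ℕ) : Prop :=
  ∀ F, Virtual n F → ∃ w : Vertex, w.Mem n ∧ RealOn n Set.univ F w

/-- Any two different edges have different colors in some coloring. -/
def Separated (n : Fin 3 → ℕ) : Prop :=
  ∀ e f : Edge, e.Mem n → f.Mem n → e ≠ f → ∃ a, Valid n a ∧ color a e ≠ color a f

/-- A half-edge belongs to a class exactly when neither path edge at its vertex does. This is why
`Virtual.local_eq` only has to compare path edges. -/
theorem color_eq_iff_of_path {n : Fin 3 → ℕ} {a a' : PathColoring} (ha : Valid n a)
    (ha' : Valid n a') {t t' : Fin 3} (h : ∀ i j, j < n i → (a i j = t ↔ a' i j = t'))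
    {e : Edge} (he : e.Mem n) : color a e = t ↔ color a' e = t' := by
  cases e with
  | path i j => exact h i j he
  | half i j =>
    simp only [Edge.Mem] at he
    simp only [color]
    rw [third_eq_iff (ha.step i j he), third_eq_iff (ha'.step i j he), Ne, Ne,
      h i j (by omega), h i (j + 1) he]

theorem Valid.congr {n : Fin 3 → ℕ} (hn : ∀ i, 1 ≤ n i) {a b : PathColoring} (ha : Valid n a)
    (h : ∀ i j, j < n i → a i j = b i j) : Valid n b := by
  refine ⟨fun i j hj => ?_, ?_, ?_⟩
  · rw [← h i j (by omega), ← h i (j + 1) hj]; exact ha.step i j hj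
  · have : (fun i => b i 0) = fun i => a i 0 := funext fun i => (h i 0 (hn i)).symm
    rw [this]; exact ha.first
  · have : (fun i => b i (n i - 1)) = fun i => a i (n i - 1) :=
      funext fun i => (h i _ (by have := hn i; omega)).symm
    rw [this]; exact ha.last

theorem Valid.relabel {n : Fin 3 → ℕ} {a : PathColoring} (ha : Valid n a)
    (σ : Equiv.Perm (Fin 3)) : Valid n fun i j => σ (a i j) :=
  ⟨fun i j hj h => ha.step i j hj (σ.injective h), σ.injective.comp ha.first,
    σ.injective.comp ha.last⟩

/-! ### Permuting the paths -/

/-- Permute the paths of an edge. -/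
def Edge.perm (σ : Equiv.Perm (Fin 3)) : Edge → Edge
  | .path i j => .path (σ i) j
  | .half i j => .half (σ i) j

/-- Permute the paths of a vertex. -/
def Vertex.perm (σ : Equiv.Perm (Fin 3)) : Vertex → Vertex
  | .first => .first
  | .last => .last
  | .inner i j => .inner (σ i) j

theorem Valid.perm {n : Fin 3 → ℕ} {a : PathColoring} (ha : Valid n a)
    (σ : Equiv.Perm (Fin 3)) : Valid (n ∘ σ) (a ∘ σ) :=
  ⟨fun i j hj => ha.step (σ i) j hj, ha.first.comp σ.injective, ha.last.comp σ.injective⟩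

theorem Valid.perm_symm {n : Fin 3 → ℕ} {a : PathColoring} {σ : Equiv.Perm (Fin 3)}
    (ha : Valid (n ∘ σ) a) : Valid n (a ∘ σ.symm) := by
  simpa [Function.comp_assoc] using ha.perm σ.symm

theorem Separated.perm {n : Fin 3 → ℕ} (h : Separated n) (σ : Equiv.Perm (Fin 3)) :
    Separated (n ∘ σ) := by
  intro e f he hf hef
  obtain ⟨a, ha, hc⟩ := h (e.perm σ) (f.perm σ) (by cases e <;> exact he)
    (by cases f <;> exact hf) (by
      cases e <;> cases f <;> simp_all [Edge.perm])
  refine ⟨a ∘ σ, ha.perm σ, ?_⟩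
  cases e <;> cases f <;> exact hc

theorem VerticesOnly.perm {n : Fin 3 → ℕ} (h : VerticesOnly n) (σ : Equiv.Perm (Fin 3)) :
    VerticesOnly (n ∘ σ) := by
  intro F hF
  have hF' : Virtual n fun a => F (a ∘ σ) :=
    ⟨fun a ha => hF.injective _ (ha.perm σ), fun a a' ha ha' t t' h =>
      hF.local_eq _ _ (ha.perm σ) (ha'.perm σ) t t' fun i j hj => h (σ i) j hj⟩
  obtain ⟨w, hw, τ, hτ⟩ := h _ hF'
  have key : ∀ a, Valid (n ∘ σ) a → ∀ s,
      F a (color (a ∘ σ.symm) (star n w s)) = τ s := by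
    intro a ha s
    have := hτ s (a ∘ σ.symm) trivial ha.perm_symm
    simpa [Function.comp_assoc] using this
  refine ⟨w.perm σ.symm, ?_, ?_⟩
  · cases w <;> simp_all [Vertex.perm, Vertex.Mem]
  · cases w with
    | first => exact ⟨τ ∘ σ, fun s a _ ha => by simpa [star, color, Vertex.perm] using key a ha (σ s)⟩
    | last => exact ⟨τ ∘ σ, fun s a _ ha => by simpa [star, color, Vertex.perm] using key a ha (σ s)⟩
    | inner i j =>
      refine ⟨τ, fun s a _ ha => ?_⟩
      rw [← key a ha s]
      fin_cases s <;> rfl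

/-! ### Colorings of the line graph -/

/-- An edge of the cubic theta graph, with indices in `ℕ`. -/
def ofEdge {n : Fin 3 → ℕ} : ThetaEdge n → Edge
  | .path i j => .path i j
  | .half i j => .half i j

/-- A vertex of the cubic theta graph, with indices in `ℕ`. -/
def ofVertex {n : Fin 3 → ℕ} : ThetaVertex n → Vertex
  | .first => .first
  | .last => .last
  | .inner i j => .inner i j

theorem ofEdge_mem {n : Fin 3 → ℕ} (e : ThetaEdge n) : (ofEdge e).Mem n := by
  cases e with
  | path i j => exact j.2
  | half i j => have := j.2; simp only [ofEdge, Edge.Mem]; omega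

theorem ofVertex_mem {n : Fin 3 → ℕ} (v : ThetaVertex n) : (ofVertex v).Mem n := by
  cases v with
  | first => trivial
  | last => trivial
  | inner i j => have := j.2; simp only [ofVertex, Vertex.Mem]; omega

theorem ofEdge_injective {n : Fin 3 → ℕ} : Function.Injective (ofEdge (n := n)) := by
  intro e f h
  cases e <;> cases f <;> simp only [ofEdge, Edge.path.injEq, Edge.half.injEq, reduceCtorEq] at h
  all_goals
    obtain ⟨rfl, h⟩ := h
    rw [Fin.ext h]

theorem exists_ofEdge {n : Fin 3 → ℕ} {e : Edge} (he : e.Mem n) : ∃ e', ofEdge (n := n) e' = e := by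
  cases e with
  | path i j => exact ⟨.path i ⟨j, he⟩, rfl⟩
  | half i j =>
    simp only [Edge.Mem] at he
    exact ⟨.half i ⟨j, by omega⟩, rfl⟩

theorem exists_ofVertex {n : Fin 3 → ℕ} {w : Vertex} (hw : w.Mem n) :
    ∃ w', ofVertex (n := n) w' = w := by
  cases w with
  | first => exact ⟨.first, rfl⟩
  | last => exact ⟨.last, rfl⟩
  | inner i j =>
    simp only [Vertex.Mem] at hw
    exact ⟨.inner i ⟨j, by omega⟩, rfl⟩

theorem first_eq_thetaPathVertex_iff {n : Fin 3 → ℕ} {i : Fin 3} {j : ℕ} :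
    .first = thetaPathVertex n i j ↔ j = 0 := by
  unfold thetaPathVertex
  split_ifs <;> simp_all

theorem last_eq_thetaPathVertex_iff {n : Fin 3 → ℕ} {i : Fin 3} {j : ℕ} (hi : 1 ≤ n i) :
    .last = thetaPathVertex n i j ↔ n i ≤ j := by
  unfold thetaPathVertex
  split_ifs <;> simp <;> omega

theorem inner_eq_thetaPathVertex_iff {n : Fin 3 → ℕ} {i i' : Fin 3} {j : ℕ}
    {j' : Fin (n i' - 1)} :
    .inner i' j' = thetaPathVertex n i j ↔ i' = i ∧ (j' : ℕ) + 1 = j := by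
  unfold thetaPathVertex
  split_ifs with h h'
  · simp; omega
  · simp only [ThetaVertex.inner.injEq]
    refine and_congr_right fun hi => ?_
    subst hi
    rw [heq_iff_eq, Fin.ext_iff]
    simp only
    omega
  · simp only [false_iff, not_and]
    rintro rfl
    have := j'.2
    omega

theorem mem_thetaEnds_iff {n : Fin 3 → ℕ} (hn : ∀ i, 1 ≤ n i) (v : ThetaVertex n)
    (e : ThetaEdge n) : v ∈ thetaEnds n e ↔ ∃ s, star n (ofVertex v) s = ofEdge e := by
  cases e with
  | path i j =>
    have hj := j.2
    have hi := hn i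
    simp only [thetaEnds, Set.mem_insert_iff, Set.mem_singleton_iff]
    cases v with
    | first =>
      simp only [first_eq_thetaPathVertex_iff, ofVertex, star, ofEdge, Edge.path.injEq]
      exact ⟨fun h => ⟨i, rfl, by omega⟩, fun ⟨s, _, h⟩ => by omega⟩
    | last =>
      simp only [last_eq_thetaPathVertex_iff hi, ofVertex, star, ofEdge, Edge.path.injEq]
      refine ⟨fun h => ⟨i, rfl, by omega⟩, ?_⟩
      rintro ⟨s, rfl, h⟩
      omega
    | inner i' j' =>
      simp only [inner_eq_thetaPathVertex_iff, ofVertex, star, ofEdge]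
      constructor
      · rintro (⟨rfl, h⟩ | ⟨rfl, h⟩)
        · exact ⟨1, by simp [h]⟩
        · exact ⟨0, by simp; omega⟩
      · rintro ⟨s, hs⟩
        fin_cases s <;> simp at hs <;> omega
  | half i j =>
    simp only [thetaEnds, Set.mem_singleton_iff]
    constructor
    · rintro rfl
      exact ⟨2, rfl⟩
    · rintro ⟨s, hs⟩
      cases v with
      | first => simp [ofVertex, star, ofEdge] at hs
      | last => simp [ofVertex, star, ofEdge] at hs
      | inner i' j' =>
        fin_cases s
        · simp [ofVertex, star, ofEdge] at hs
        · simp [ofVertex, star, ofEdge] at hs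
        · simp only [ofVertex, star, ofEdge, Fin.reduceFinMk, Matrix.cons_val,
            Edge.half.injEq] at hs
          obtain ⟨rfl, h⟩ := hs
          rw [Fin.ext h]

/-- The cubic theta graph for a function `n` of path lengths. -/
def graph (n : Fin 3 → ℕ) : HalfEdgeGraph (ThetaVertex n) (ThetaEdge n) where
  ends := thetaEnds n
  ncard_ends e := by
    cases e with
    | path i j => exact Or.inr (Set.ncard_pair (thetaPathVertex_ne _ i j))
    | half i j => exact Or.inl (Set.ncard_singleton _)

theorem lineGraph_adj_iff {n : Fin 3 → ℕ} (hn : ∀ i, 1 ≤ n i) (e f : ThetaEdge n) :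
    (graph n).lineGraph.Adj e f ↔ e ≠ f ∧ ∃ w : Vertex, w.Mem n ∧
      (∃ s, star n w s = ofEdge e) ∧ ∃ s, star n w s = ofEdge f := by
  refine and_congr_right fun _ => ⟨?_, ?_⟩
  · rintro ⟨v, he, hf⟩
    exact ⟨ofVertex v, ofVertex_mem v, (mem_thetaEnds_iff hn v e).1 he,
      (mem_thetaEnds_iff hn v f).1 hf⟩
  · rintro ⟨w, hw, he, hf⟩
    obtain ⟨v, rfl⟩ := exists_ofVertex hw
    exact ⟨v, (mem_thetaEnds_iff hn v e).2 he, (mem_thetaEnds_iff hn v f).2 hf⟩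

theorem exists_star_eq {n : Fin 3 → ℕ} {e : Edge} (he : e.Mem n) :
    ∃ w : Vertex, w.Mem n ∧ ∃ s, star n w s = e := by
  cases e with
  | path i j =>
    simp only [Edge.Mem] at he
    by_cases h : j + 1 < n i
    · exact ⟨.inner i j, h, 0, rfl⟩
    · refine ⟨.last, trivial, i, ?_⟩
      simp only [star]
      congr 1; omega
  | half i j => exact ⟨.inner i j, he, 2, rfl⟩

/-- The coloring of the line graph given by a valid coloring of the paths. -/
def toColoring {n : Fin 3 → ℕ} (hn : ∀ i, 1 ≤ n i) {a : PathColoring} (ha : Valid n a) :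
    (graph n).lineGraph.Coloring (Fin 3) :=
  SimpleGraph.Coloring.mk (fun e => color a (ofEdge e)) fun {e f} hef => by
    obtain ⟨hne, w, hw, ⟨s, hs⟩, s', hs'⟩ := (lineGraph_adj_iff hn e f).1 hef
    intro h
    rw [← hs, ← hs'] at h
    have := ha.color_star_injective hw h
    subst this
    exact hne (ofEdge_injective (hs.symm.trans hs'))

/-- The colors of the edges of the paths. -/
def ofColoring {n : Fin 3 → ℕ} (c : ThetaEdge n → Fin 3) : PathColoring :=
  fun i j => if h : j < n i then c (.path i ⟨j, h⟩) else 0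

theorem color_star_ne {n : Fin 3 → ℕ} (hn : ∀ i, 1 ≤ n i)
    (c : (graph n).lineGraph.Coloring (Fin 3)) {e f : ThetaEdge n} {w : Vertex} (hw : w.Mem n)
    {s s' : Fin 3} (he : star n w s = ofEdge e) (hf : star n w s' = ofEdge f) (hef : e ≠ f) :
    c e ≠ c f :=
  c.valid ((lineGraph_adj_iff hn e f).2 ⟨hef, w, hw, ⟨s, he⟩, s', hf⟩)

theorem valid_ofColoring {n : Fin 3 → ℕ} (hn : ∀ i, 1 ≤ n i)
    (c : (graph n).lineGraph.Coloring (Fin 3)) : Valid n (ofColoring c) := by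
  refine ⟨fun i j hj => ?_, fun i i' h => ?_, fun i i' h => ?_⟩
  · simp only [ofColoring]
    rw [dif_pos (by omega : j < n i), dif_pos hj]
    exact color_star_ne hn c (w := .inner i j) hj (s := 0) (s' := 1) rfl rfl (by simp)
  · have hi := hn i
    have hi' := hn i'
    simp only [ofColoring] at h
    rw [dif_pos (by omega), dif_pos (by omega)] at h
    by_contra hne
    exact color_star_ne hn c (w := .first) trivial (s := i) (s' := i') rfl rfl (by simp [hne]) h
  · have hi := hn i
    have hi' := hn i'
    simp only [ofColoring] at h
    rw [dif_pos (by omega), dif_pos (by omega)] at h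
    by_contra hne
    exact color_star_ne hn c (w := .last) trivial (s := i) (s' := i') rfl rfl (by simp [hne]) h

theorem color_ofColoring {n : Fin 3 → ℕ} (hn : ∀ i, 1 ≤ n i)
    (c : (graph n).lineGraph.Coloring (Fin 3)) (e : ThetaEdge n) :
    color (ofColoring c) (ofEdge e) = c e := by
  cases e with
  | path i j => simp [color, ofEdge, ofColoring]
  | half i j =>
    have hj := j.2
    have hj' : (j : ℕ) + 1 < n i := by omega
    simp only [color, ofEdge, ofColoring]
    rw [dif_pos (by omega), dif_pos hj']
    symm
    refine eq_third ?_ ?_ ?_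
    · exact color_star_ne hn c (w := .inner i j) hj' (s := 0) (s' := 1) rfl rfl (by simp)
    · exact color_star_ne hn c (w := .inner i j) hj' (s := 2) (s' := 0) rfl rfl (by simp)
    · exact color_star_ne hn c (w := .inner i j) hj' (s := 2) (s' := 1) rfl rfl (by simp)

/-! ### The coloring complex -/

/-- The coloring complex of the line graph. -/
abbrev edgeComplex (n : Fin 3 → ℕ) := coloringComplex 3 (graph n).lineGraph

/-- A vertex of a coloring complex given as a color class. -/
def classVertex {V : Type*} {X : SimpleGraph V} (c : X.Coloring (Fin 3)) (t : Fin 3) :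
    {S : Set V // ∃ (c : X.Coloring (Fin 3)) (i : Fin 3), c.colorClass i = S} :=
  ⟨c.colorClass t, c, t, rfl⟩

theorem mem_classVertex {V : Type*} {X : SimpleGraph V} (c : X.Coloring (Fin 3)) (t : Fin 3)
    (v : V) : v ∈ (classVertex c t).1 ↔ c v = t := Iff.rfl

theorem exists_edge_of_color {n : Fin 3 → ℕ} (hn : ∀ i, 1 ≤ n i)
    (c : (graph n).lineGraph.Coloring (Fin 3)) {w : Vertex} (hw : w.Mem n) (t : Fin 3) :
    ∃ e s, star n w s = ofEdge e ∧ c e = t := by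
  obtain ⟨s, hs⟩ := (Finite.injective_iff_surjective.1
    ((valid_ofColoring hn c).color_star_injective hw)) t
  obtain ⟨e, he⟩ := exists_ofEdge (star_mem hn hw s)
  refine ⟨e, s, he.symm, ?_⟩
  rw [← color_ofColoring hn c, he]
  exact hs

theorem edgeComplex_adj_classVertex {n : Fin 3 → ℕ} (hn : ∀ i, 1 ≤ n i)
    (c : (graph n).lineGraph.Coloring (Fin 3)) {t t' : Fin 3} (h : t ≠ t') :
    (edgeComplex n).Adj (classVertex c t) (classVertex c t') := by
  refine ⟨fun heq => ?_, c, t, t', rfl, rfl⟩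
  obtain ⟨e, -, -, he⟩ := exists_edge_of_color hn c (w := .first) trivial t
  have : e ∈ (classVertex c t').1 := heq ▸ he
  exact h (he.symm.trans this)

open Classical in
/-- The function on colorings given by a 3-coloring of the coloring complex. -/
noncomputable def ofComplexColoring {n : Fin 3 → ℕ} (hn : ∀ i, 1 ≤ n i)
    (ψ : (edgeComplex n).Coloring (Fin 3)) : PathColoring → Fin 3 → Fin 3 :=
  fun a t => if ha : Valid n a then ψ (classVertex (toColoring hn ha) t) else 0

theorem virtual_ofComplexColoring {n : Fin 3 → ℕ} (hn : ∀ i, 1 ≤ n i)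
    (ψ : (edgeComplex n).Coloring (Fin 3)) : Virtual n (ofComplexColoring hn ψ) := by
  refine ⟨fun a ha t t' h => ?_, fun a a' ha ha' t t' h => ?_⟩
  · by_contra hne
    simp only [ofComplexColoring, dif_pos ha] at h
    exact ψ.valid (edgeComplex_adj_classVertex hn (toColoring hn ha) hne) h
  · simp only [ofComplexColoring, dif_pos ha, dif_pos ha']
    congr 1
    apply Subtype.ext
    ext e
    exact color_eq_iff_of_path ha ha' h (ofEdge_mem e)

theorem ofComplexColoring_ofColoring {n : Fin 3 → ℕ} (hn : ∀ i, 1 ≤ n i)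
    (ψ : (edgeComplex n).Coloring (Fin 3)) (c : (graph n).lineGraph.Coloring (Fin 3))
    (t : Fin 3) : ofComplexColoring hn ψ (ofColoring c) t = ψ (classVertex c t) := by
  simp only [ofComplexColoring, dif_pos (valid_ofColoring hn c)]
  congr 1
  apply Subtype.ext
  ext e
  rw [mem_classVertex, mem_classVertex, ← color_ofColoring hn c]
  rfl

/-- The 3-coloring of the coloring complex given by a function on colorings. -/
noncomputable def toComplexColoring {n : Fin 3 → ℕ} (hn : ∀ i, 1 ≤ n i)
    {F : PathColoring → Fin 3 → Fin 3} (hF : Virtual n F) : (edgeComplex n).Coloring (Fin 3) :=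
  SimpleGraph.Coloring.mk (fun S => F (ofColoring S.2.choose) S.2.choose_spec.choose)
    fun {S T} ⟨hne, c, i, j, hi, hj⟩ => by
      -- The chosen representative does not matter: two descriptions of one class agree on the path
      -- edges.
      have key : ∀ (S : {S : Set (ThetaEdge n) // ∃ (c : (graph n).lineGraph.Coloring (Fin 3))
          (i : Fin 3), c.colorClass i = S}) (k : Fin 3), c.colorClass k = S.1 →
          F (ofColoring S.2.choose) S.2.choose_spec.choose = F (ofColoring c) k := by
        intro S k hk
        refine hF.local_eq _ _ (valid_ofColoring hn _) (valid_ofColoring hn _) _ _ ?_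
        intro i j hj
        have h := S.2.choose_spec.choose_spec.trans hk.symm
        have h' := Set.ext_iff.1 h (.path i ⟨j, hj⟩)
        simpa [ofColoring, hj, SimpleGraph.Coloring.colorClass] using h'
      rw [key S i hi, key T j hj]
      intro h
      have := hF.injective _ (valid_ofColoring hn c) h
      subst this
      exact hne (Subtype.ext (hi.symm.trans hj))

theorem toComplexColoring_apply {n : Fin 3 → ℕ} (hn : ∀ i, 1 ≤ n i)
    {F : PathColoring → Fin 3 → Fin 3} (hF : Virtual n F)
    (c : (graph n).lineGraph.Coloring (Fin 3)) (t : Fin 3) :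
    toComplexColoring hn hF (classVertex c t) = F (ofColoring c) t := by
  refine hF.local_eq _ _ (valid_ofColoring hn _) (valid_ofColoring hn _) _ _ ?_
  intro i j hj
  have h := (classVertex c t).2.choose_spec.choose_spec
  have h' := Set.ext_iff.1 h (.path i ⟨j, hj⟩)
  simpa [ofColoring, hj, SimpleGraph.Coloring.colorClass, classVertex] using h'

open Classical in
/-- The edge at `w` that has the color given by a color class. -/
noncomputable def vertexFunction (n : Fin 3 → ℕ) (w : Vertex) : PathColoring → Fin 3 → Fin 3 :=
  fun a t => if h : ∃ s, color a (star n w s) = t then h.choose else 0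

theorem vertexFunction_eq_iff {n : Fin 3 → ℕ} {w : Vertex} (hw : w.Mem n) {a : PathColoring}
    (ha : Valid n a) (t s : Fin 3) :
    vertexFunction n w a t = s ↔ color a (star n w s) = t := by
  have h : ∃ s, color a (star n w s) = t :=
    Finite.injective_iff_surjective.1 (ha.color_star_injective hw) t
  simp only [vertexFunction, dif_pos h]
  constructor
  · rintro rfl; exact h.choose_spec
  · intro hs
    exact ha.color_star_injective hw (h.choose_spec.trans hs.symm)

theorem virtual_vertexFunction {n : Fin 3 → ℕ} (hn : ∀ i, 1 ≤ n i) {w : Vertex} (hw : w.Mem n) :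
    Virtual n (vertexFunction n w) := by
  refine ⟨fun a ha t t' h => ?_, fun a a' ha ha' t t' h => ?_⟩
  · exact ((vertexFunction_eq_iff hw ha t _).1 rfl).symm.trans
      ((vertexFunction_eq_iff hw ha t' _).1 h.symm)
  · rw [vertexFunction_eq_iff hw ha, color_eq_iff_of_path ha ha' h (star_mem hn hw _)]
    exact (vertexFunction_eq_iff hw ha' _ _).1 rfl

/-- Shows that the canonical image of an edge really is a color class of the coloring complex, and
that edges at a common vertex have images in a common 3-coloring. -/
theorem classes_eq_colorClass {n : Fin 3 → ℕ} (hn : ∀ i, 1 ≤ n i) {w : Vertex} (hw : w.Mem n)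
    {s : Fin 3} {e : ThetaEdge n} (he : star n w s = ofEdge e) :
    (toComplexColoring hn (virtual_vertexFunction hn hw)).colorClass s = {C | e ∈ C.1} := by
  ext ⟨C, c, t, rfl⟩
  have : toComplexColoring hn (virtual_vertexFunction hn hw) (classVertex c t) = s ↔ c e = t := by
    rw [toComplexColoring_apply, vertexFunction_eq_iff hw (valid_ofColoring hn c), he,
      color_ofColoring hn]
  exact this

/-! ### Edge-reflexivity in terms of path colorings -/

theorem classes_injective {n : Fin 3 → ℕ} (hn : ∀ i, 1 ≤ n i) (h : Separated n) {e f : ThetaEdge n}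
    (hef : {C : {S : Set (ThetaEdge n) // ∃ (c : (graph n).lineGraph.Coloring (Fin 3)) (i : Fin 3),
      c.colorClass i = S} | e ∈ C.1} = {C | f ∈ C.1}) : e = f := by
  by_contra hne
  obtain ⟨a, ha, hc⟩ := h (ofEdge e) (ofEdge f) (ofEdge_mem e) (ofEdge_mem f)
    fun h => hne (ofEdge_injective h)
  have := (Set.ext_iff.1 hef (classVertex (toColoring hn ha) (color a (ofEdge e)))).1 rfl
  exact hc (Eq.symm this)

theorem Separated.exists_valid {n : Fin 3 → ℕ} (hn : ∀ i, 1 ≤ n i) (h : Separated n) :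
    ∃ a, Valid n a := by
  obtain ⟨a, ha, -⟩ := h (.path 0 0) (.path 1 0) (hn 0) (hn 1) (by simp)
  exact ⟨a, ha⟩

/-- A color class of the coloring complex consists of the classes that contain some edge. -/
theorem exists_colorClass_eq {n : Fin 3 → ℕ} (hn : ∀ i, 1 ≤ n i) (hs : Separated n)
    (hv : VerticesOnly n) (ψ : (edgeComplex n).Coloring (Fin 3)) :
    ∃ w : Vertex, w.Mem n ∧ ∀ t, ∃ e s, star n w s = ofEdge e ∧
      ψ.colorClass t = {C | e ∈ C.1} := by
  obtain ⟨w, hw, τ, hτ⟩ := hv _ (virtual_ofComplexColoring hn ψ)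
  obtain ⟨a, ha⟩ := hs.exists_valid hn
  -- One existing coloring suffices to see that `τ` is a bijection from edges at `w` to labels.
  have hinj : Function.Injective τ := by
    intro s s' h
    rw [← hτ s a trivial ha, ← hτ s' a trivial ha] at h
    exact ha.color_star_injective hw ((virtual_ofComplexColoring hn ψ).injective a ha h)
  refine ⟨w, hw, fun t => ?_⟩
  obtain ⟨s, rfl⟩ := Finite.injective_iff_surjective.1 hinj t
  obtain ⟨e, he⟩ := exists_ofEdge (star_mem hn hw s)
  refine ⟨e, s, he.symm, ?_⟩
  ext ⟨C, c, t, rfl⟩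
  have h1 := hτ s _ trivial (valid_ofColoring hn c)
  rw [← he, color_ofColoring hn] at h1
  have : ψ (classVertex c t) = τ s ↔ c e = t := by
    rw [← ofComplexColoring_ofColoring hn, ← h1]
    exact ⟨fun h => ((virtual_ofComplexColoring hn ψ).injective _ (valid_ofColoring hn c) h).symm,
      fun h => by rw [h]⟩
  exact this

/-- Since every 3-coloring of the complex consists of the images of the three edges at one vertex,
the canonical map is onto, and images that are adjacent come from edges with a common vertex. -/
theorem edgeReflexive_of {n : Fin 3 → ℕ} (hn : ∀ i, 1 ≤ n i) (hs : Separated n)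
    (hv : VerticesOnly n) : (graph n).EdgeReflexive := by
  obtain ⟨a, ha⟩ := hs.exists_valid hn
  refine ⟨⟨toColoring hn ha⟩, ?_⟩
  have hφ : ∀ e : ThetaEdge n, ∃ (ψ : (edgeComplex n).Coloring (Fin 3)) (i : Fin 3),
      ψ.colorClass i = {C | e ∈ C.1} := by
    intro e
    obtain ⟨w, hw, s, hs⟩ := exists_star_eq (ofEdge_mem e)
    exact ⟨_, _, classes_eq_colorClass hn hw hs⟩
  have hbij : Function.Bijective fun e : ThetaEdge n =>
      (⟨{C | e ∈ C.1}, hφ e⟩ : {S // ∃ (ψ : (edgeComplex n).Coloring (Fin 3)) (i : Fin 3),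
        ψ.colorClass i = S}) := by
    refine ⟨fun e f h => classes_injective hn hs (Subtype.ext_iff.1 h), ?_⟩
    rintro ⟨S, ψ, t, rfl⟩
    obtain ⟨w, -, h⟩ := exists_colorClass_eq hn hs hv ψ
    obtain ⟨e, -, -, he⟩ := h t
    exact ⟨e, Subtype.ext he.symm⟩
  refine ⟨⟨Equiv.ofBijective _ hbij, ?_⟩, fun v => rfl⟩
  intro e f
  rw [lineGraph_adj_iff hn]
  constructor
  · rintro ⟨hne, ψ, i, j, hi, hj⟩
    obtain ⟨w, hw, h⟩ := exists_colorClass_eq hn hs hv ψ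
    obtain ⟨e', s, hs1, he'⟩ := h i
    obtain ⟨f', s', hs2, hf'⟩ := h j
    obtain rfl : e' = e := classes_injective hn hs (he'.symm.trans hi)
    obtain rfl : f' = f := classes_injective hn hs (hf'.symm.trans hj)
    exact ⟨fun h => hne (by rw [h]), w, hw, ⟨s, hs1⟩, s', hs2⟩
  · rintro ⟨hne, w, hw, ⟨s, he⟩, s', hf⟩
    exact ⟨fun h => hne (hbij.1 h), toComplexColoring hn (virtual_vertexFunction hn hw), s, s',
      classes_eq_colorClass hn hw he, classes_eq_colorClass hn hw hf⟩

theorem EdgeReflexive.separated {n : Fin 3 → ℕ} (hn : ∀ i, 1 ≤ n i)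
    (h : (graph n).EdgeReflexive) : Separated n := by
  obtain ⟨-, f, hf⟩ := h
  intro e₁ e₂ h₁ h₂ hne
  obtain ⟨e₁, rfl⟩ := exists_ofEdge h₁
  obtain ⟨e₂, rfl⟩ := exists_ofEdge h₂
  by_contra! hcon
  refine hne (congrArg _ (f.injective (Subtype.ext ?_)))
  rw [hf, hf]
  ext ⟨C, c, t, rfl⟩
  have := hcon _ (valid_ofColoring hn c)
  rw [color_ofColoring hn, color_ofColoring hn] at this
  have : c e₁ = t ↔ c e₂ = t := by rw [this]
  exact this

/-- By surjectivity the classes labelled 0 and 1 are the images of two edges. These images are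
adjacent, so the edges meet at a vertex, and the third edge there must get the remaining label. -/
theorem EdgeReflexive.verticesOnly {n : Fin 3 → ℕ} (hn : ∀ i, 1 ≤ n i)
    (h : (graph n).EdgeReflexive) : VerticesOnly n := by
  obtain ⟨⟨c₀⟩, f, hf⟩ := h
  intro F hF
  have hcl : ∀ t, ∃ e, {C : {S : Set (ThetaEdge n) //
      ∃ (c : (graph n).lineGraph.Coloring (Fin 3)) (i : Fin 3), c.colorClass i = S} | e ∈ C.1} =
      (toComplexColoring hn hF).colorClass t := by
    intro t
    obtain ⟨e, he⟩ := f.surjective (classVertex (toComplexColoring hn hF) t)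
    exact ⟨e, by rw [← hf, he]; rfl⟩
  have hval : ∀ t e, {C : {S : Set (ThetaEdge n) //
      ∃ (c : (graph n).lineGraph.Coloring (Fin 3)) (i : Fin 3), c.colorClass i = S} | e ∈ C.1} =
      (toComplexColoring hn hF).colorClass t → ∀ a, Valid n a → F a (color a (ofEdge e)) = t := by
    intro t e he a ha
    have h1 := (Set.ext_iff.1 he (classVertex (toColoring hn ha) (color a (ofEdge e)))).1 rfl
    have h2 : toComplexColoring hn hF (classVertex (toColoring hn ha) (color a (ofEdge e))) = t :=
      h1
    rw [toComplexColoring_apply] at h2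
    rw [← h2]
    refine hF.local_eq _ _ ha (valid_ofColoring hn _) _ _ fun i j hj => ?_
    have : ofColoring (toColoring hn ha) i j = a i j := by
      simp only [ofColoring, dif_pos hj]
      rfl
    rw [this]
  obtain ⟨e₀, he₀⟩ := hcl 0
  obtain ⟨e₁, he₁⟩ := hcl 1
  have hadj : (graph n).lineGraph.Adj e₀ e₁ := by
    rw [← f.map_rel_iff]
    refine ⟨fun h => ?_, toComplexColoring hn hF, 0, 1, ?_, ?_⟩
    · have h' := Subtype.ext_iff.1 h
      rw [hf, hf, he₀, he₁] at h'
      obtain ⟨t, ht⟩ := Finite.injective_iff_surjective.1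
        (hF.injective _ (valid_ofColoring hn c₀)) 0
      rw [← toComplexColoring_apply hn hF] at ht
      have h2 := (Set.ext_iff.1 h' (classVertex c₀ t)).1 ht
      have h3 : toComplexColoring hn hF (classVertex c₀ t) = 1 := h2
      rw [ht] at h3
      exact absurd h3 (by decide)
    · rw [hf, he₀]
    · rw [hf, he₁]
  obtain ⟨hne, w, hw, ⟨s₀, hs₀⟩, s₁, hs₁⟩ := (lineGraph_adj_iff hn _ _).1 hadj
  have hs : s₀ ≠ s₁ := by
    rintro rfl
    exact hne (ofEdge_injective (hs₀.symm.trans hs₁))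
  refine ⟨w, hw, fun s => if s = s₀ then 0 else if s = s₁ then 1 else 2, fun s a _ ha => ?_⟩
  have h₀ := hval 0 e₀ he₀ a ha
  have h₁ := hval 1 e₁ he₁ a ha
  rw [← hs₀] at h₀
  rw [← hs₁] at h₁
  have hinj := (hF.injective a ha).comp (ha.color_star_injective hw)
  dsimp only
  split_ifs with h h'
  · rw [h, h₀]
  · rw [h', h₁]
  · have n0 : F a (color a (star n w s)) ≠ 0 := fun h0 => h (hinj (h0.trans h₀.symm))
    have n1 : F a (color a (star n w s)) ≠ 1 := fun h0 => h' (hinj (h0.trans h₁.symm))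
    revert n0 n1
    generalize F a (color a (star n w s)) = x
    revert x; decide

/-- The property of the three path lengths that characterizes edge-reflexivity. -/
def Reflexive (k l m : ℕ) : Prop := Separated ![k, l, m] ∧ VerticesOnly ![k, l, m]

theorem thetaGraph_edgeReflexive_iff {k l m : ℕ} (hk : 1 ≤ k) (hl : 1 ≤ l) (hm : 1 ≤ m) :
    (thetaGraph k l m).EdgeReflexive ↔ Reflexive k l m := by
  have hn : ∀ i, 1 ≤ ![k, l, m] i := by
    intro i; fin_cases i <;> assumption
  exact ⟨fun h => ⟨EdgeReflexive.separated hn h, EdgeReflexive.verticesOnly hn h⟩,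
    fun h => edgeReflexive_of hn h.1 h.2⟩

/-! ### Deciding the properties for given path lengths -/

/-- Append the bits `p 0, …, p (k - 1)` to the binary number `acc`. -/
def appendBits (acc : ℕ) (p : ℕ → Bool) : ℕ → ℕ
  | 0 => acc
  | k + 1 => 2 * appendBits acc p k + (p k).toNat

theorem appendBits_eq_iff {acc acc' : ℕ} {p p' : ℕ → Bool} {k : ℕ} :
    appendBits acc p k = appendBits acc' p' k ↔ acc = acc' ∧ ∀ j < k, p j = p' j := by
  induction k with
  | zero => simp [appendBits]
  | succ k ih =>
    have : appendBits acc p (k + 1) = appendBits acc' p' (k + 1) ↔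
        appendBits acc p k = appendBits acc' p' k ∧ p k = p' k := by
      simp only [appendBits]
      cases p k <;> cases p' k <;> simp <;> omega
    rw [this, ih, and_assoc, Nat.forall_lt_succ_right]

/-- A number that encodes a color class. -/
def code (n : Fin 3 → ℕ) (a : PathColoring) (t : Fin 3) : ℕ :=
  appendBits (appendBits (appendBits 0 (fun j => a 0 j == t) (n 0))
    (fun j => a 1 j == t) (n 1)) (fun j => a 2 j == t) (n 2)

theorem code_eq_iff {n : Fin 3 → ℕ} {a a' : PathColoring} {t t' : Fin 3} :
    code n a t = code n a' t' ↔ ∀ i j, j < n i → (a i j = t ↔ a' i j = t') := by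
  have h : ∀ x y : Fin 3, (x == t) = (y == t') ↔ (x = t ↔ y = t') := fun x y => by
    rw [Bool.eq_iff_iff, beq_iff_eq, beq_iff_eq]
  simp only [code, appendBits_eq_iff, true_and, h]
  constructor
  · rintro ⟨⟨h0, h1⟩, h2⟩ i
    fin_cases i
    exacts [h0, h1, h2]
  · exact fun h => ⟨⟨h 0, h 1⟩, h 2⟩

/-- The walks with `k` steps from `x` among the three colors. -/
def walks (x : Fin 3) : ℕ → List (List (Fin 3))
  | 0 => [[x]]
  | k + 1 => (walks (x + 1) k ++ walks (x + 2) k).map (x :: ·)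

theorem map_range_mem_walks {k : ℕ} {f : ℕ → Fin 3} (h : ∀ j < k, f j ≠ f (j + 1)) :
    (List.range (k + 1)).map f ∈ walks (f 0) k := by
  induction k generalizing f with
  | zero => simp [walks]
  | succ k ih =>
    have h' := ih (f := fun j => f (j + 1)) fun j hj => h (j + 1) (by omega)
    rw [List.range_succ_eq_map, List.map_cons, List.map_map]
    simp only [walks, List.mem_map, List.cons.injEq, true_and, exists_eq_right, List.mem_append]
    have h0 : f 0 + 1 = f 1 ∨ f 0 + 2 = f 1 := by
      have := h 0 (by omega)
      revert this
      simp only [zero_add]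
      generalize f 0 = x
      generalize f 1 = y
      revert x y; decide
    rcases h0 with h0 | h0
    · exact Or.inl (h0 ▸ h')
    · exact Or.inr (h0 ▸ h')

/-- A decision procedure for `Valid`. -/
def validB (n : Fin 3 → ℕ) (a : PathColoring) : Bool :=
  a 0 (n 0 - 1) != a 1 (n 1 - 1) && (a 1 (n 1 - 1) != a 2 (n 2 - 1) &&
  (a 0 (n 0 - 1) != a 2 (n 2 - 1) && (a 0 0 != a 1 0 && (a 1 0 != a 2 0 && (a 0 0 != a 2 0 &&
    [0, 1, 2].all fun i => (List.range (n i - 1)).all fun j => a i j != a i (j + 1))))))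

theorem injective_fin_three_iff {f : Fin 3 → Fin 3} :
    Function.Injective f ↔ f 0 ≠ f 1 ∧ f 1 ≠ f 2 ∧ f 0 ≠ f 2 := by
  revert f; decide

theorem validB_eq_true {n : Fin 3 → ℕ} {a : PathColoring} : validB n a = true ↔ Valid n a := by
  have : Valid n a ↔ (∀ i j, j + 1 < n i → a i j ≠ a i (j + 1)) ∧
      (Function.Injective fun i => a i 0) ∧ Function.Injective fun i => a i (n i - 1) :=
    ⟨fun h => ⟨h.step, h.first, h.last⟩, fun h => ⟨h.1, h.2.1, h.2.2⟩⟩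
  rw [this, injective_fin_three_iff, injective_fin_three_iff]
  simp only [validB, Bool.and_eq_true, bne_iff_ne, List.all_cons, List.all_nil,
    List.all_eq_true, List.mem_range, Fin.forall_fin_succ, ← Nat.lt_sub_iff_add_lt]
  simp only [Fin.succ_zero_eq_one, Fin.succ_one_eq_two, IsEmpty.forall_iff]
  tauto

/-- The coloring of the paths given by three lists. -/
def ofLists (p q r : List (Fin 3)) : PathColoring
  | 0 => fun j => p.getD j 0
  | 1 => fun j => q.getD j 0
  | 2 => fun j => r.getD j 0

/-- The valid colorings that have color `i` on the first edge of the path `i`. -/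
def colorings (n : Fin 3 → ℕ) : List PathColoring :=
  ((walks 0 (n 0 - 1)).flatMap fun p => (walks 1 (n 1 - 1)).flatMap fun q =>
    (walks 2 (n 2 - 1)).map fun r => ofLists p q r).filter (validB n)

theorem valid_of_mem_colorings {n : Fin 3 → ℕ} {a : PathColoring} (h : a ∈ colorings n) :
    Valid n a :=
  validB_eq_true.1 (List.mem_filter.1 h).2

theorem getD_map_range {f : ℕ → Fin 3} {j k : ℕ} (h : j < k) :
    ((List.range k).map f).getD j 0 = f j := by
  simp [List.getD, h]

/-- The first edges of the paths have three different colors, so renaming colors makes them `0, 1,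
2`. One coloring per orbit is enough because renaming does not change the classes. -/
theorem exists_mem_colorings {n : Fin 3 → ℕ} (hn : ∀ i, 1 ≤ n i) {a : PathColoring}
    (ha : Valid n a) : ∃ b ∈ colorings n, ∃ σ : Equiv.Perm (Fin 3),
      ∀ i j, j < n i → a i j = σ (b i j) := by
  let σ : Equiv.Perm (Fin 3) := Equiv.ofBijective _ (Finite.injective_iff_bijective.1 ha.first)
  let b : PathColoring := fun i j => σ.symm (a i j)
  have hb : Valid n b := ha.relabel σ.symm
  have hb0 : ∀ i, b i 0 = i := fun i => σ.symm_apply_apply i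
  let p := fun i => (List.range (n i - 1 + 1)).map (b i)
  have hp : ∀ i, p i ∈ walks i (n i - 1) := by
    intro i
    have := map_range_mem_walks (f := b i) (k := n i - 1) fun j hj => hb.step i j (by omega)
    rwa [hb0] at this
  have heq : ∀ i j, j < n i → b i j = ofLists (p 0) (p 1) (p 2) i j := by
    intro i j hj
    have : (p i).getD j 0 = b i j := getD_map_range (by omega)
    rw [← this]
    fin_cases i <;> rfl
  refine ⟨ofLists (p 0) (p 1) (p 2), ?_, σ, fun i j hj => ?_⟩
  · refine List.mem_filter.2 ⟨?_, validB_eq_true.2 (hb.congr hn heq)⟩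
    simp only [List.mem_flatMap, List.mem_map]
    exact ⟨_, hp 0, _, hp 1, _, hp 2, rfl⟩
  · rw [← heq i j hj]
    exact (σ.apply_symm_apply _).symm

theorem third_relabel (σ : Equiv.Perm (Fin 3)) {x y : Fin 3} (h : x ≠ y) :
    third (σ x) (σ y) = σ (third x y) :=
  (eq_third (σ.injective.ne h) (σ.injective.ne (third_ne_left h))
    (σ.injective.ne (third_ne_right h))).symm

theorem color_relabel {n : Fin 3 → ℕ} {a b : PathColoring} (hb : Valid n b)
    {σ : Equiv.Perm (Fin 3)} (h : ∀ i j, j < n i → a i j = σ (b i j)) {e : Edge} (he : e.Mem n) :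
    color a e = σ (color b e) := by
  cases e with
  | path i j => exact h i j he
  | half i j =>
    simp only [Edge.Mem] at he
    simp only [color]
    rw [h i j (by omega), h i (j + 1) he, third_relabel σ (hb.step i j he)]

theorem Virtual.relabel {n : Fin 3 → ℕ} {F : PathColoring → Fin 3 → Fin 3} (hF : Virtual n F)
    {a b : PathColoring} (ha : Valid n a) (hb : Valid n b)
    {σ : Equiv.Perm (Fin 3)} (h : ∀ i j, j < n i → a i j = σ (b i j)) (t : Fin 3) :
    F a (σ t) = F b t :=
  hF.local_eq a b ha hb _ _ fun i j hj => by rw [h i j hj, σ.injective.eq_iff]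

/-! ### Exhaustive search over partial labellings coded in base 4 -/

/-- The digit with index `m` of `A` in base 4. -/
def digit (A m : ℕ) : ℕ := Nat.mod (Nat.div A (Nat.pow 4 m)) 4

theorem digit_def (A m : ℕ) : digit A m = A / 4 ^ m % 4 := rfl

theorem digit_add_of_ne {A m m' c : ℕ} (hA : digit A m = 0) (hc : c < 4) (h : m' ≠ m) :
    digit (A + c * 4 ^ m) m' = digit A m' := by
  simp only [digit_def] at *
  rcases lt_or_gt_of_ne h with h | h
  · obtain ⟨d, rfl⟩ : ∃ d, m = m' + (d + 1) := ⟨m - m' - 1, by omega⟩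
    have : A + c * 4 ^ (m' + (d + 1)) = A + 4 ^ m' * (4 * (4 ^ d * c)) := by ring
    rw [this, Nat.add_mul_div_left _ _ (by positivity), Nat.add_mul_mod_self_left]
  · obtain ⟨d, rfl⟩ : ∃ d, m' = m + 1 + d := ⟨m' - m - 1, by omega⟩
    rw [pow_add, ← Nat.div_div_eq_div_mul, ← Nat.div_div_eq_div_mul, pow_succ,
      ← Nat.div_div_eq_div_mul, ← Nat.div_div_eq_div_mul, Nat.add_mul_div_right _ _ (by positivity)]
    congr 2
    omega

theorem digit_add_self {A m c : ℕ} (hA : digit A m = 0) (hc : c < 4) :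
    digit (A + c * 4 ^ m) m = c := by
  simp only [digit_def] at *
  rw [Nat.add_mul_div_right _ _ (by positivity)]
  omega

/-- Set the digit with index `m` to `c` and go on with `k`, unless it has a different nonzero
value. -/
def put (A m c : ℕ) (k : ℕ → Bool) : Bool :=
  bif Nat.beq (digit A m) 0 then k (Nat.add A (Nat.mul c (Nat.pow 4 m))) else
    bif Nat.beq (digit A m) c then k A else true

/-- All digits of `A` that have been set are given by `g`. -/
def Agrees (A : ℕ) (g : ℕ → ℕ) : Prop := ∀ m, digit A m = 0 ∨ digit A m = g m

/-- A conflict makes `put` return `true` without calling `k`, but a partial labelling that agrees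
with `g` never runs into a conflict when the value of `g` is put. -/
theorem Agrees.exists_of_put {A : ℕ} {g : ℕ → ℕ} (h : Agrees A g) {m c : ℕ} (hm : g m = c)
    (hc : c < 4) {k : ℕ → Bool} (hk : put A m c k = true) : ∃ B, Agrees B g ∧ k B = true := by
  unfold put at hk
  subst hm
  by_cases h0 : digit A m = 0
  · rw [h0, Nat.beq_refl] at hk
    refine ⟨_, fun m' => ?_, hk⟩
    by_cases hmm : m' = m
    · subst hmm
      exact Or.inr (digit_add_self h0 hc)
    · have := digit_add_of_ne h0 hc hmm
      have h' := h m'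
      rw [← this] at h'
      exact h'
  · have h1 := (h m).resolve_left h0
    rw [Bool.eq_false_iff.2 fun h => h0 (Nat.eq_of_beq_eq_true h), h1, Nat.beq_refl] at hk
    exact ⟨A, h, hk⟩

theorem exists_of_put_eq_false {A m c : ℕ} {k : ℕ → Bool} (h : put A m c k = false) :
    ∃ B, k B = false := by
  unfold put at h
  cases h0 : Nat.beq (digit A m) 0 <;> cases h1 : Nat.beq (digit A m) c <;>
    rw [h0] at h <;> simp only [cond_false, cond_true, h1, Bool.true_eq_false] at h
  exacts [⟨_, h⟩, ⟨_, h⟩, ⟨_, h⟩]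

/-- Check `P` for all ways to give the three classes of every coloring the three colors `1`, `2`,
`3`. It is written with the recursor for the sake of kernel reduction. -/
def search (P : ℕ → Bool) (T : List (ℕ × ℕ × ℕ)) : ℕ → Bool :=
  List.rec (motive := fun _ => ℕ → Bool) P (fun x _ k A =>
    (put A x.1 1 fun B => (put B x.2.1 2 fun C => put C x.2.2 3 k) &&
      (put B x.2.1 3 fun C => put C x.2.2 2 k)) &&
    ((put A x.1 2 fun B => (put B x.2.1 1 fun C => put C x.2.2 3 k) &&
      (put B x.2.1 3 fun C => put C x.2.2 1 k)) &&
    (put A x.1 3 fun B => (put B x.2.1 1 fun C => put C x.2.2 2 k) &&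
      (put B x.2.1 2 fun C => put C x.2.2 1 k)))) T

/-- The three classes get the three colors `1`, `2`, `3`. -/
def Rainbow (g : ℕ → ℕ) (x : ℕ × ℕ × ℕ) : Prop :=
  (g x.1, g x.2.1, g x.2.2) ∈
    [(1, 2, 3), (1, 3, 2), (2, 1, 3), (2, 3, 1), (3, 1, 2), (3, 2, 1)]

/-- Among the six branches for each coloring, follow the one prescribed by `g`. -/
theorem Agrees.exists_of_search {A : ℕ} {g : ℕ → ℕ} {P : ℕ → Bool} {T : List (ℕ × ℕ × ℕ)}
    (h : Agrees A g) (hT : ∀ x ∈ T, Rainbow g x) (hP : search P T A = true) :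
    ∃ B, Agrees B g ∧ P B = true := by
  induction T generalizing A with
  | nil => exact ⟨A, h, hP⟩
  | cons x T ih =>
    replace ih := fun {A} (h : Agrees A g) hP =>
      ih (A := A) h (fun x hx => hT x (List.mem_cons_of_mem _ hx)) hP
    have hx := hT _ List.mem_cons_self
    change ((put A x.1 1 fun B => (put B x.2.1 2 fun C => put C x.2.2 3 (search P T)) &&
        (put B x.2.1 3 fun C => put C x.2.2 2 (search P T))) &&
      ((put A x.1 2 fun B => (put B x.2.1 1 fun C => put C x.2.2 3 (search P T)) &&
        (put B x.2.1 3 fun C => put C x.2.2 1 (search P T))) &&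
      (put A x.1 3 fun B => (put B x.2.1 1 fun C => put C x.2.2 2 (search P T)) &&
        (put B x.2.1 2 fun C => put C x.2.2 1 (search P T))))) = true at hP
    simp only [Bool.and_eq_true] at hP
    obtain ⟨h1, h2, h3⟩ := hP
    simp only [Rainbow, List.mem_cons, Prod.mk.injEq, List.not_mem_nil, or_false] at hx
    have key : ∀ {c d e}, g x.1 = c → g x.2.1 = d → g x.2.2 = e → c < 4 → d < 4 → e < 4 →
        ∀ {k : ℕ → Bool}, put A x.1 c k = true →
        (∀ B, k B = true → put B x.2.1 d (fun C => put C x.2.2 e (search P T)) = true) →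
        ∃ B, Agrees B g ∧ P B = true := by
      intro c d e hc hd he hc' hd' he' k hk hk'
      obtain ⟨B, hB, hB'⟩ := h.exists_of_put hc hc' hk
      obtain ⟨C, hC, hC'⟩ := hB.exists_of_put hd hd' (hk' B hB')
      obtain ⟨D, hD, hD'⟩ := hC.exists_of_put he he' hC'
      exact ih hD hD'
    rcases hx with ⟨a, b, c⟩ | ⟨a, b, c⟩ | ⟨a, b, c⟩ | ⟨a, b, c⟩ | ⟨a, b, c⟩ | ⟨a, b, c⟩
    · exact key a b c (by decide) (by decide) (by decide) h1 fun B hB => (Bool.and_eq_true_iff.1 hB).1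
    · exact key a b c (by decide) (by decide) (by decide) h1 fun B hB => (Bool.and_eq_true_iff.1 hB).2
    · exact key a b c (by decide) (by decide) (by decide) h2 fun B hB => (Bool.and_eq_true_iff.1 hB).1
    · exact key a b c (by decide) (by decide) (by decide) h2 fun B hB => (Bool.and_eq_true_iff.1 hB).2
    · exact key a b c (by decide) (by decide) (by decide) h3 fun B hB => (Bool.and_eq_true_iff.1 hB).1
    · exact key a b c (by decide) (by decide) (by decide) h3 fun B hB => (Bool.and_eq_true_iff.1 hB).2

/-- Nothing is claimed about how `B` was reached; whoever uses a negative answer lets `P` check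
everything needed about `B`. -/
theorem exists_of_search_eq_false {A : ℕ} {P : ℕ → Bool} {T : List (ℕ × ℕ × ℕ)}
    (h : search P T A = false) : ∃ B, P B = false := by
  induction T generalizing A with
  | nil => exact ⟨A, h⟩
  | cons x T ih =>
    change ((put A x.1 1 fun B => (put B x.2.1 2 fun C => put C x.2.2 3 (search P T)) &&
        (put B x.2.1 3 fun C => put C x.2.2 2 (search P T))) &&
      ((put A x.1 2 fun B => (put B x.2.1 1 fun C => put C x.2.2 3 (search P T)) &&
        (put B x.2.1 3 fun C => put C x.2.2 1 (search P T))) &&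
      (put A x.1 3 fun B => (put B x.2.1 1 fun C => put C x.2.2 2 (search P T)) &&
        (put B x.2.1 2 fun C => put C x.2.2 1 (search P T))))) = false at h
    simp only [Bool.and_eq_false_iff] at h
    rcases h with h | h | h
    all_goals
      obtain ⟨B, h⟩ := exists_of_put_eq_false h
      rw [Bool.and_eq_false_iff] at h
      rcases h with h | h
      all_goals
        obtain ⟨C, h⟩ := exists_of_put_eq_false h
        obtain ⟨D, h⟩ := exists_of_put_eq_false h
        exact ih h

/-- The search with the colors for the first coloring fixed. -/
def searchFrom (P : ℕ → Bool) : List (ℕ × ℕ × ℕ) → Bool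
  | [] => P 0
  | x :: T => put 0 x.1 1 fun B => put B x.2.1 2 fun C => put C x.2.2 3 (search P T)

theorem exists_of_searchFrom_eq_false {P : ℕ → Bool} {T : List (ℕ × ℕ × ℕ)}
    (h : searchFrom P T = false) : ∃ B, P B = false := by
  cases T with
  | nil => exact ⟨0, h⟩
  | cons x T =>
    change put 0 x.1 1 (fun B => put B x.2.1 2 fun C => put C x.2.2 3 (search P T)) = false at h
    obtain ⟨B, h⟩ := exists_of_put_eq_false h
    obtain ⟨C, h⟩ := exists_of_put_eq_false h
    obtain ⟨D, h⟩ := exists_of_put_eq_false h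
    exact exists_of_search_eq_false h

/-- The codes of the three classes of the colorings. -/
def triples (n : Fin 3 → ℕ) : List (ℕ × ℕ × ℕ) :=
  (colorings n).map fun a => (code n a 0, code n a 1, code n a 2)

/-- The vertices of the theta graph. -/
def vertices (n : Fin 3 → ℕ) : List Vertex :=
  .first :: .last :: [0, 1, 2].flatMap fun i => (List.range (n i - 1)).map fun j => .inner i j

theorem mem_vertices {n : Fin 3 → ℕ} {w : Vertex} : w ∈ vertices n ↔ w.Mem n := by
  cases w with
  | first => simp [vertices, Vertex.Mem]
  | last => simp [vertices, Vertex.Mem]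
  | inner i j =>
    simp only [vertices, Vertex.Mem, List.mem_cons, reduceCtorEq, false_or, List.mem_flatMap,
      List.mem_map, List.mem_range, Vertex.inner.injEq]
    constructor
    · rintro ⟨i', -, j', h, rfl, rfl⟩; omega
    · intro h
      exact ⟨i, by fin_cases i <;> simp, j, by omega, rfl, rfl⟩

/-- The same as `code`, with fewer different terms for the kernel to reduce. -/
def codeAt (n : Fin 3 → ℕ) (a : PathColoring) : Fin 3 → ℕ
  | 0 => code n a 0
  | 1 => code n a 1
  | 2 => code n a 2

theorem codeAt_eq (n : Fin 3 → ℕ) (a : PathColoring) (t : Fin 3) : codeAt n a t = code n a t := by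
  fin_cases t <;> rfl

/-- The colors of the classes in `A` are given by the edges at some vertex. -/
def realB (n : Fin 3 → ℕ) (A : ℕ) : Bool :=
  (vertices n).any fun w => [0, 1, 2].all fun s => [1, 2, 3].any fun t =>
    (colorings n).all fun a => digit A (codeAt n a (color a (star n w s))) == t

theorem verticesOnly_of_searchFrom {n : Fin 3 → ℕ} (hn : ∀ i, 1 ≤ n i)
    (h : searchFrom (realB n) (triples n) = true) : VerticesOnly n := by
  classical
  intro F hF
  rcases hcol : colorings n with _ | ⟨a₀, L⟩
  · refine ⟨.first, trivial, fun _ => 0, fun s a _ ha => ?_⟩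
    obtain ⟨b, hb, -⟩ := exists_mem_colorings hn ha
    simp [hcol] at hb
  have ha₀ : a₀ ∈ colorings n := by simp [hcol]
  -- Labels are renamed so that the classes of `a₀` get `0, 1, 2`, matching the fixed start of
  -- `searchFrom`.
  let ρ : Equiv.Perm (Fin 3) := Equiv.ofBijective _
    (Finite.injective_iff_bijective.1 (hF.injective a₀ (valid_of_mem_colorings ha₀)))
  -- Labels are shifted by one because the digit 0 means "not yet set".
  let g : ℕ → ℕ := fun m => if h : ∃ a t, Valid n a ∧ code n a t = m then
    (ρ.symm (F h.choose h.choose_spec.choose) : ℕ) + 1 else 0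
  have hg : ∀ a t, Valid n a → g (code n a t) = ρ.symm (F a t) + 1 := by
    intro a t ha
    have h : ∃ a' t', Valid n a' ∧ code n a' t' = code n a t := ⟨a, t, ha, rfl⟩
    simp only [g, dif_pos h]
    rw [hF.local_eq _ _ h.choose_spec.choose_spec.1 ha _ _
      (code_eq_iff.1 h.choose_spec.choose_spec.2)]
  have hrain : ∀ a, Valid n a → Rainbow g (code n a 0, code n a 1, code n a 2) := by
    intro a ha
    have hinj := ρ.symm.injective.comp (hF.injective a ha)
    simp only [Rainbow, hg a _ ha]
    have h01 := hinj.ne (show (0 : Fin 3) ≠ 1 by decide)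
    have h02 := hinj.ne (show (0 : Fin 3) ≠ 2 by decide)
    have h12 := hinj.ne (show (1 : Fin 3) ≠ 2 by decide)
    simp only [Function.comp] at h01 h02 h12
    revert h01 h02 h12
    generalize ρ.symm (F a 0) = x
    generalize ρ.symm (F a 1) = y
    generalize ρ.symm (F a 2) = z
    revert x y z; decide
  have hrainT : ∀ x ∈ triples n, Rainbow g x := by
    intro x hx
    obtain ⟨a, ha, rfl⟩ := List.mem_map.1 hx
    exact hrain a (valid_of_mem_colorings ha)
  obtain ⟨A, hAg, hreal⟩ : ∃ A, Agrees A g ∧ realB n A = true := by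
    have hρ : ∀ t, (ρ.symm (F a₀ t) : ℕ) = t := fun t => by
      rw [show F a₀ t = ρ t from rfl, ρ.symm_apply_apply]
    have hT : triples n = (code n a₀ 0, code n a₀ 1, code n a₀ 2) ::
        L.map fun a => (code n a 0, code n a 1, code n a 2) := by
      simp [triples, hcol]
    have hA₀ : Agrees 0 g := fun m => Or.inl (by simp [digit_def])
    have h0 := hg a₀ 0 (valid_of_mem_colorings ha₀)
    have h1 := hg a₀ 1 (valid_of_mem_colorings ha₀)
    have h2 := hg a₀ 2 (valid_of_mem_colorings ha₀)
    rw [hρ] at h0 h1 h2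
    rw [hT] at hrainT h
    change put 0 (code n a₀ 0) 1 (fun B => put B (code n a₀ 1) 2 fun C =>
      put C (code n a₀ 2) 3 (search _ _)) = true at h
    obtain ⟨B, hB, hB'⟩ := hA₀.exists_of_put (c := 1) h0 (by decide) h
    obtain ⟨C, hC, hC'⟩ := hB.exists_of_put (c := 2) h1 (by decide) hB'
    obtain ⟨D, hD, hD'⟩ := hC.exists_of_put (c := 3) h2 (by decide) hC'
    exact hD.exists_of_search (fun x hx => hrainT x (List.mem_cons_of_mem _ hx)) hD'
  simp only [realB, List.any_eq_true, List.all_eq_true, beq_iff_eq, codeAt_eq,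
    mem_vertices] at hreal
  obtain ⟨w, hw, hreal⟩ := hreal
  refine ⟨w, hw, ?_⟩
  have key : ∀ s, ∃ t, ∀ a ∈ colorings n, F a (color a (star n w s)) = t := by
    intro s
    obtain ⟨t, ht, hst⟩ := hreal s (by fin_cases s <;> simp)
    refine ⟨F a₀ (color a₀ (star n w s)), fun a ha => ?_⟩
    have hval : ∀ a ∈ colorings n, (ρ.symm (F a (color a (star n w s))) : ℕ) + 1 = t := by
      intro a ha
      rw [← hg a _ (valid_of_mem_colorings ha), ← hst a ha]
      refine ((hAg _).resolve_left ?_).symm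
      rw [hst a ha]
      rintro rfl
      simp at ht
    have h1 := hval a ha
    have h2 := hval a₀ ha₀
    exact ρ.symm.injective (Fin.ext (by omega))
  choose τ hτ using key
  refine ⟨τ, fun s a _ ha => ?_⟩
  obtain ⟨b, hb, σ, hσ⟩ := exists_mem_colorings hn ha
  have hbv := valid_of_mem_colorings hb
  rw [color_relabel hbv hσ (star_mem hn hw s), hF.relabel ha hbv hσ, hτ s b hb]

/-- The digits for the three classes of a coloring are nonzero and different. -/
def rainbowB (n : Fin 3 → ℕ) (A : ℕ) (a : PathColoring) : Bool :=
  digit A (code n a 0) != 0 && (digit A (code n a 1) != 0 && (digit A (code n a 2) != 0 &&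
    (digit A (code n a 0) != digit A (code n a 1) && (digit A (code n a 1) != digit A (code n a 2)
      && digit A (code n a 0) != digit A (code n a 2)))))

/-- The predicate rechecks that the labelling found is complete, bijective on each representative
coloring, and given by no vertex. Hence its digits directly define a counterexample. -/
theorem not_verticesOnly_of_searchFrom {n : Fin 3 → ℕ} (hn : ∀ i, 1 ≤ n i)
    (h : searchFrom (fun A => !((colorings n).all (rainbowB n A) && !realB n A)) (triples n) =
      false) : ¬ VerticesOnly n := by
  intro hv
  obtain ⟨A, h⟩ := exists_of_searchFrom_eq_false h
  simp only [Bool.not_eq_false', Bool.and_eq_true, List.all_eq_true, Bool.not_eq_true'] at h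
  obtain ⟨hA, hreal⟩ := h
  -- Reduction mod 3 is injective on the digits `1, 2, 3`, and digits of the same class agree
  -- automatically.
  let F : PathColoring → Fin 3 → Fin 3 := fun a t => Fin.ofNat 3 (digit A (code n a t))
  have hlt : ∀ m, digit A m < 4 := fun m => Nat.mod_lt _ (by decide)
  have hpos : ∀ a ∈ colorings n, ∀ t, digit A (code n a t) ≠ 0 := by
    intro a ha t
    have := hA a ha
    simp only [rainbowB, Bool.and_eq_true, bne_iff_ne] at this
    fin_cases t
    · exact this.1
    · exact this.2.1
    · exact this.2.2.1
  have hof : ∀ x y : ℕ, x < 4 → y < 4 → x ≠ 0 → y ≠ 0 → Fin.ofNat 3 x = Fin.ofNat 3 y →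
      x = y := by
    intro x y _ _ _ _ h
    have := congrArg Fin.val h
    simp only [Fin.ofNat] at this
    omega
  have hrel : ∀ (a b : PathColoring) (σ : Equiv.Perm (Fin 3)),
      (∀ i j, j < n i → a i j = σ (b i j)) → ∀ t, F a (σ t) = F b t := by
    intro a b σ h t
    have : code n a (σ t) = code n b t :=
      code_eq_iff.2 fun i j hj => by rw [h i j hj, σ.injective.eq_iff]
    simp only [F, this]
  have hF : Virtual n F := by
    refine ⟨fun a ha => ?_, fun a a' ha ha' t t' h => ?_⟩
    · obtain ⟨b, hb, σ, hσ⟩ := exists_mem_colorings hn ha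
      have hinj : Function.Injective (F b) := by
        rw [injective_fin_three_iff]
        have h := hA b hb
        simp only [rainbowB, Bool.and_eq_true, bne_iff_ne] at h
        exact ⟨fun he => h.2.2.2.1 (hof _ _ (hlt _) (hlt _) (hpos b hb _) (hpos b hb _) he),
          fun he => h.2.2.2.2.1 (hof _ _ (hlt _) (hlt _) (hpos b hb _) (hpos b hb _) he),
          fun he => h.2.2.2.2.2 (hof _ _ (hlt _) (hlt _) (hpos b hb _) (hpos b hb _) he)⟩
      have : F a = F b ∘ σ.symm := by
        funext t
        rw [Function.comp_apply, ← hrel a b σ hσ, σ.apply_symm_apply]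
      rw [this]
      exact hinj.comp σ.symm.injective
    · simp only [F]
      rw [code_eq_iff.2 h]
  obtain ⟨w, hw, τ, hτ⟩ := hv F hF
  rw [← Bool.not_eq_true] at hreal
  apply hreal
  simp only [realB, List.any_eq_true, List.all_eq_true, beq_iff_eq, codeAt_eq,
    mem_vertices]
  refine ⟨w, hw, fun s _ => ?_⟩
  rcases hcol : colorings n with _ | ⟨a₀, L⟩
  · exact ⟨1, by simp, by simp⟩
  rw [← hcol]
  have ha₀ : a₀ ∈ colorings n := by simp [hcol]
  refine ⟨digit A (code n a₀ (color a₀ (star n w s))), ?_, fun a ha => ?_⟩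
  · have h1 := hlt (code n a₀ (color a₀ (star n w s)))
    have h2 := hpos a₀ ha₀ (color a₀ (star n w s))
    simp only [List.mem_cons, List.not_mem_nil, or_false]
    omega
  · refine hof _ _ (hlt _) (hlt _) (hpos a ha _) (hpos a₀ ha₀ _) ?_
    exact (hτ s a trivial (valid_of_mem_colorings ha)).trans
      (hτ s a₀ trivial (valid_of_mem_colorings ha₀)).symm

/-- The edges of the theta graph. -/
def edges (n : Fin 3 → ℕ) : List Edge :=
  [0, 1, 2].flatMap fun i => (List.range (n i)).map (Edge.path i) ++
    (List.range (n i - 1)).map (Edge.half i)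

theorem mem_edges_of_mem {n : Fin 3 → ℕ} {e : Edge} (h : e.Mem n) : e ∈ edges n := by
  simp only [edges, List.mem_flatMap]
  cases e with
  | path i j => exact ⟨i, by fin_cases i <;> simp, by simpa [Edge.Mem] using h⟩
  | half i j =>
    simp only [Edge.Mem] at h
    exact ⟨i, by fin_cases i <;> simp, by simp; omega⟩

theorem separated_of_all {n : Fin 3 → ℕ}
    (h : ((edges n).all fun e => (edges n).all fun f => e == f ||
      (colorings n).any fun a => color a e != color a f) = true) : Separated n := by
  intro e f he hf hne
  simp only [List.all_eq_true, Bool.or_eq_true, beq_iff_eq, List.any_eq_true, bne_iff_ne] at h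
  obtain ⟨a, ha, hc⟩ := (h e (mem_edges_of_mem he) f (mem_edges_of_mem hf)).resolve_left hne
  exact ⟨a, valid_of_mem_colorings ha, hc⟩

/-! ### Small path lengths -/

/-- The positive cases treated by search are those the induction cannot reach: longest path at most
4; shortest path 1 and longest 5, where removing three edges destroys `Separated`; and `2, 2, 5` and
`2, 3, 5`, whose predecessors are exceptional. -/
theorem verticesOnly_1_1_1 : VerticesOnly ![1, 1, 1] :=
  verticesOnly_of_searchFrom (by decide) (by decide +kernel)

theorem verticesOnly_1_3_3 : VerticesOnly ![1, 3, 3] :=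
  verticesOnly_of_searchFrom (by decide) (by decide +kernel)

theorem verticesOnly_1_3_4 : VerticesOnly ![1, 3, 4] :=
  verticesOnly_of_searchFrom (by decide) (by decide +kernel)

theorem verticesOnly_1_4_4 : VerticesOnly ![1, 4, 4] :=
  verticesOnly_of_searchFrom (by decide) (by decide +kernel)

theorem verticesOnly_1_3_5 : VerticesOnly ![1, 3, 5] :=
  verticesOnly_of_searchFrom (by decide) (by decide +kernel)

theorem verticesOnly_1_4_5 : VerticesOnly ![1, 4, 5] :=
  verticesOnly_of_searchFrom (by decide) (by decide +kernel)

theorem verticesOnly_1_5_5 : VerticesOnly ![1, 5, 5] :=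
  verticesOnly_of_searchFrom (by decide) (by decide +kernel)

theorem verticesOnly_2_2_5 : VerticesOnly ![2, 2, 5] :=
  verticesOnly_of_searchFrom (by decide) (by decide +kernel)

theorem verticesOnly_2_3_5 : VerticesOnly ![2, 3, 5] :=
  verticesOnly_of_searchFrom (by decide) (by decide +kernel)

theorem verticesOnly_2_4_4 : VerticesOnly ![2, 4, 4] :=
  verticesOnly_of_searchFrom (by decide) (by decide +kernel)

theorem verticesOnly_3_3_4 : VerticesOnly ![3, 3, 4] :=
  verticesOnly_of_searchFrom (by decide) (by decide +kernel)

theorem verticesOnly_3_4_4 : VerticesOnly ![3, 4, 4] :=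
  verticesOnly_of_searchFrom (by decide) (by decide +kernel)

theorem verticesOnly_4_4_4 : VerticesOnly ![4, 4, 4] :=
  verticesOnly_of_searchFrom (by decide) (by decide +kernel)

theorem not_verticesOnly_2_2_2 : ¬ VerticesOnly ![2, 2, 2] :=
  not_verticesOnly_of_searchFrom (by decide) (by decide +kernel)

theorem not_verticesOnly_2_2_3 : ¬ VerticesOnly ![2, 2, 3] :=
  not_verticesOnly_of_searchFrom (by decide) (by decide +kernel)

theorem not_verticesOnly_2_2_4 : ¬ VerticesOnly ![2, 2, 4] :=
  not_verticesOnly_of_searchFrom (by decide) (by decide +kernel)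

theorem not_verticesOnly_2_3_3 : ¬ VerticesOnly ![2, 3, 3] :=
  not_verticesOnly_of_searchFrom (by decide) (by decide +kernel)

theorem not_verticesOnly_2_3_4 : ¬ VerticesOnly ![2, 3, 4] :=
  not_verticesOnly_of_searchFrom (by decide) (by decide +kernel)

theorem not_verticesOnly_3_3_3 : ¬ VerticesOnly ![3, 3, 3] :=
  not_verticesOnly_of_searchFrom (by decide) (by decide +kernel)

theorem separated_1_1_1 : Separated ![1, 1, 1] := separated_of_all (by decide +kernel)

theorem separated_1_3_3 : Separated ![1, 3, 3] := separated_of_all (by decide +kernel)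

theorem separated_2_2_2 : Separated ![2, 2, 2] := separated_of_all (by decide +kernel)

theorem separated_2_2_3 : Separated ![2, 2, 3] := separated_of_all (by decide +kernel)

theorem separated_2_3_3 : Separated ![2, 3, 3] := separated_of_all (by decide +kernel)

theorem separated_3_3_3 : Separated ![3, 3, 3] := separated_of_all (by decide +kernel)

/-! ### Lengthening a path -/

/-- The path lengths with the path `2` made longer by one. -/
def grow (n : Fin 3 → ℕ) : Fin 3 → ℕ := Function.update n 2 (n 2 + 1)

@[simp] theorem grow_two (n : Fin 3 → ℕ) : grow n 2 = n 2 + 1 := by simp [grow]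

theorem grow_of_ne (n : Fin 3 → ℕ) {i : Fin 3} (h : i ≠ 2) : grow n i = n i := by simp [grow, h]

/-- Replace the colors of the path `2`. -/
def setPath (a : PathColoring) (x : ℕ → Fin 3) : PathColoring := Function.update a 2 x

@[simp] theorem setPath_two (a : PathColoring) (x : ℕ → Fin 3) : setPath a x 2 = x := by
  simp [setPath]

theorem setPath_of_ne (a : PathColoring) (x : ℕ → Fin 3) {i : Fin 3} (h : i ≠ 2) :
    setPath a x i = a i := by simp [setPath, h]

theorem Valid.setPath {n n' : Fin 3 → ℕ} {a : PathColoring} (ha : Valid n a) {x : ℕ → Fin 3}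
    (hn : ∀ i, i ≠ 2 → n' i = n i) (hx : ∀ j, j + 1 < n' 2 → x j ≠ x (j + 1)) (h0 : x 0 = a 2 0)
    (hl : x (n' 2 - 1) = a 2 (n 2 - 1)) : Valid n' (setPath a x) := by
  refine ⟨fun i j hj => ?_, ?_, ?_⟩
  · by_cases hi : i = 2
    · subst hi
      rw [setPath_two]; exact hx j hj
    · rw [setPath_of_ne _ _ hi]
      exact ha.step i j (hn i hi ▸ hj)
  · convert ha.first using 2 with i
    by_cases hi : i = 2
    · subst hi
      rw [setPath_two, h0]
    · rw [setPath_of_ne _ _ hi]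
  · convert ha.last using 2 with i
    by_cases hi : i = 2
    · subst hi
      rw [setPath_two, hl]
    · rw [setPath_of_ne _ _ hi, hn i hi]

/-- Insert the third color between the colors `x p` and `x (p + 1)`. -/
def insertThird (p : ℕ) (x : ℕ → Fin 3) : ℕ → Fin 3 := fun j =>
  if j ≤ p then x j else if j = p + 1 then third (x p) (x (p + 1)) else x (j - 1)

/-- Insert the third color in the path `2`. -/
def insertAt (p : ℕ) (a : PathColoring) : PathColoring := setPath a (insertThird p (a 2))

theorem Valid.insertAt {n : Fin 3 → ℕ} {a : PathColoring} (ha : Valid n a) {p : ℕ}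
    (hp : p + 1 < n 2) : Valid (grow n) (insertAt p a) := by
  refine ha.setPath (fun i hi => grow_of_ne n hi) (fun j hj => ?_) ?_ ?_
  · rw [grow_two] at hj
    have hp' := ha.step 2 p hp
    unfold insertThird
    rcases lt_trichotomy j p with h | rfl | h
    · rw [if_pos h.le, if_pos (by omega)]
      exact ha.step 2 j (by omega)
    · rw [if_pos le_rfl, if_neg (by omega), if_pos rfl]
      exact (third_ne_left hp').symm
    · rw [if_neg (by omega), if_neg (by omega : ¬ j + 1 ≤ p), if_neg (by omega : ¬ j + 1 = p + 1)]
      split_ifs with h'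
      · subst h'
        exact third_ne_right hp'
      · have := ha.step 2 (j - 1) (by omega)
        rwa [show j - 1 + 1 = j + 1 - 1 by omega] at this
  · simp [insertThird]
  · rw [grow_two, insertThird, if_neg (by omega), if_neg (by omega)]
    rfl

/-- Delete the edge `p + 1` of the path. The hypothesis keeps the coloring proper and forces the
deleted color to be the third one. -/
theorem exists_insertAt_eq {n : Fin 3 → ℕ} {b : PathColoring} (hb : Valid (grow n) b) {p : ℕ}
    (hp : p + 1 < n 2) (h : b 2 p ≠ b 2 (p + 2)) : ∃ a, Valid n a ∧ insertAt p a = b := by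
  have h1 := hb.step 2 p (by rw [grow_two]; omega)
  have h2 := hb.step 2 (p + 1) (by rw [grow_two]; omega)
  refine ⟨setPath b fun j => if j ≤ p then b 2 j else b 2 (j + 1), ?_, ?_⟩
  · refine hb.setPath (fun i hi => (grow_of_ne n hi).symm) (fun j hj => ?_) ?_ ?_
    · rcases lt_trichotomy j p with h' | rfl | h'
      · rw [if_pos h'.le, if_pos (by omega)]
        exact hb.step 2 j (by rw [grow_two]; omega)
      · rw [if_pos le_rfl, if_neg (by omega)]
        exact h
      · rw [if_neg (by omega), if_neg (by omega)]
        exact hb.step 2 (j + 1) (by rw [grow_two]; omega)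
    · simp
    · rw [if_neg (by omega), grow_two]
      congr 1; omega
  · funext i
    by_cases hi : i = 2
    · subst hi
      funext j
      simp only [insertAt, setPath_two, insertThird, le_refl, if_true]
      rw [if_neg (by omega : ¬ p + 1 ≤ p)]
      split_ifs with h' h'' h'''
      · rfl
      · subst h''
        exact (eq_third h h1.symm h2).symm
      · omega
      · congr 1; omega
    · rw [insertAt, setPath_of_ne _ _ hi, setPath_of_ne _ _ hi]

theorem Virtual.insertAt {n : Fin 3 → ℕ} {F : PathColoring → Fin 3 → Fin 3}
    (hF : Virtual (grow n) F) {p : ℕ} (hp : p + 1 < n 2) :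
    Virtual n fun a => F (insertAt p a) := by
  refine ⟨fun a ha => hF.injective _ (ha.insertAt hp), fun a a' ha ha' t t' h =>
    hF.local_eq _ _ (ha.insertAt hp) (ha'.insertAt hp) t t' fun i j hj => ?_⟩
  by_cases hi : i = 2
  · subst hi
    rw [grow_two] at hj
    simp only [CubicTheta.insertAt, setPath_two, insertThird]
    split_ifs
    · exact h 2 j (by omega)
    · rw [third_eq_iff (ha.step 2 p hp), third_eq_iff (ha'.step 2 p hp), Ne, Ne,
        h 2 p (by omega), h 2 (p + 1) hp]
    · exact h 2 (j - 1) (by omega)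
  · simp only [CubicTheta.insertAt, setPath_of_ne _ _ hi]
    exact h i j (grow_of_ne n hi ▸ hj)

/-- The edge of the shorter graph that has the same color after inserting the third color. -/
def Edge.shrink (p : ℕ) : Edge → Edge
  | .path i j => if i = 2 then
      if j ≤ p then .path 2 j else if j = p + 1 then .half 2 p else .path 2 (j - 1)
    else .path i j
  | .half i j => if i = 2 then
      if j < p then .half 2 j else if j = p then .path 2 (p + 1) else
        if j = p + 1 then .path 2 p else .half 2 (j - 1)
    else .half i j

/-- If the path edges at the vertex have colors `x, y` and the half-edge has `z`, the new path has
`x, z, y` there, with half-edges colored `y` and `x`. So each new edge copies an old one. -/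
theorem color_insertAt (p : ℕ) (a : PathColoring) (e : Edge) :
    color (insertAt p a) e = color a (e.shrink p) := by
  cases e with
  | path i j =>
    by_cases hi : i = 2
    · subst hi
      simp only [color, insertAt, setPath_two, insertThird, Edge.shrink, if_true]
      split_ifs <;> rfl
    · simp only [color, insertAt, setPath_of_ne _ _ hi, Edge.shrink, if_neg hi]
  | half i j =>
    by_cases hi : i = 2
    · subst hi
      simp only [color, insertAt, setPath_two, insertThird, Edge.shrink, if_true]
      rcases lt_trichotomy j p with h | rfl | h
      · rw [if_pos h.le, if_pos (by omega), if_pos h]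
      · rw [if_pos le_rfl, if_neg (by omega), if_pos rfl, if_neg (by omega), if_pos rfl]
        exact third_third_right
      · rw [if_neg (by omega), if_neg (by omega : ¬ j + 1 ≤ p), if_neg (by omega : ¬ j + 1 = p + 1),
          if_neg (by omega : ¬ j < p), if_neg (by omega : ¬ j = p)]
        split_ifs with h'
        · subst h'
          rw [third_comm, third_comm (a 2 p)]
          exact third_third_right
        · simp only
          congr 2
          omega
    · simp only [color, insertAt, setPath_of_ne _ _ hi, Edge.shrink, if_neg hi]

theorem Edge.Mem.shrink {n : Fin 3 → ℕ} {p : ℕ} (hp : p + 1 < n 2) {e : Edge}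
    (he : e.Mem (grow n)) : (e.shrink p).Mem n := by
  cases e with
  | path i j =>
    by_cases hi : i = 2
    · subst hi
      simp only [Edge.Mem, grow_two] at he
      simp only [Edge.shrink, if_true]
      split_ifs <;> simp only [Edge.Mem] <;> omega
    · simp only [Edge.shrink, if_neg hi, Edge.Mem, grow_of_ne _ hi] at he ⊢
      exact he
  | half i j =>
    by_cases hi : i = 2
    · subst hi
      simp only [Edge.Mem, grow_two] at he
      simp only [Edge.shrink, if_true]
      split_ifs <;> simp only [Edge.Mem] <;> omega
    · simp only [Edge.shrink, if_neg hi, Edge.Mem, grow_of_ne _ hi] at he ⊢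
      exact he

/-- `Edge.shrink p` only identifies `path 2 p` with `half 2 (p + 1)`, and `half 2 p` with `path 2 (p
+ 2)`. The pairs for `p = 0` and `p = 1` are different, so one of the two insertions separates any
two given edges. -/
theorem Edge.shrink_injective {e f : Edge} (h0 : e.shrink 0 = f.shrink 0)
    (h1 : e.shrink 1 = f.shrink 1) : e = f := by
  cases e <;> cases f <;> simp only [Edge.shrink] at h0 h1 <;> split_ifs at h0 h1 <;>
    simp only [Edge.path.injEq, Edge.half.injEq, reduceCtorEq] at h0 h1 ⊢ <;> grind

theorem Separated.grow {n : Fin 3 → ℕ} (h : Separated n) (hn : 3 ≤ n 2) : Separated (grow n) := by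
  intro e f he hf hne
  obtain ⟨p, hp, hpne⟩ : ∃ p, p + 1 < n 2 ∧ e.shrink p ≠ f.shrink p := by
    by_contra! hcon
    exact hne (Edge.shrink_injective (hcon 0 (by omega)) (hcon 1 (by omega)))
  obtain ⟨a, ha, hc⟩ := h _ _ (he.shrink hp) (hf.shrink hp) hpne
  exact ⟨insertAt p a, ha.insertAt hp, by rwa [color_insertAt, color_insertAt]⟩

/-- Carries a vertex of the shorter graph to the longer one. At the insertion point the path edge
and the half-edge exchange roles, which is why the indices `s` and `s'` may differ. -/
theorem exists_shrink_star_eq {n : Fin 3 → ℕ} {p : ℕ} (hp : p + 1 < n 2) {w : Vertex}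
    (hw : w.Mem n) : ∃ w' : Vertex, w'.Mem (grow n) ∧
      ∀ s, ∃ s', (star (grow n) w' s).shrink p = star n w s' := by
  cases w with
  | first =>
    refine ⟨.first, trivial, fun s => ⟨s, ?_⟩⟩
    by_cases hs : s = 2
    · subst hs; simp [star, Edge.shrink]
    · simp [star, Edge.shrink, hs]
  | last =>
    refine ⟨.last, trivial, fun s => ⟨s, ?_⟩⟩
    by_cases hs : s = 2
    · subst hs
      simp only [star, Edge.shrink, grow_two, if_true]
      rw [if_neg (by omega), if_neg (by omega)]
      rfl
    · simp [star, Edge.shrink, hs, grow_of_ne _ hs]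
  | inner i j =>
    simp only [Vertex.Mem] at hw
    by_cases hi : i = 2
    · subst hi
      rcases lt_trichotomy j p with h | rfl | h
      · refine ⟨.inner 2 j, by simp only [Vertex.Mem, grow_two]; omega, fun s => ⟨s, ?_⟩⟩
        fin_cases s <;> simp [star, Edge.shrink] <;> omega
      · refine ⟨.inner 2 j, by simp only [Vertex.Mem, grow_two]; omega, fun s => ?_⟩
        fin_cases s
        · exact ⟨0, by simp [star, Edge.shrink]⟩
        · exact ⟨2, by simp [star, Edge.shrink]⟩
        · exact ⟨1, by simp [star, Edge.shrink]⟩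
      · refine ⟨.inner 2 (j + 1), by simp only [Vertex.Mem, grow_two]; omega, fun s => ⟨s, ?_⟩⟩
        have h1 : ¬ j + 1 ≤ p := by omega
        have h2 : ¬ j + 1 + 1 ≤ p := by omega
        have h3 : ¬ j + 1 < p := by omega
        have h4 : ¬ j + 1 = p := by omega
        have h5 : j ≠ p := by omega
        fin_cases s <;> simp [star, Edge.shrink, h1, h2, h3, h4, h5]
    · refine ⟨.inner i j, by simpa only [Vertex.Mem, grow_of_ne _ hi] using hw, fun s => ⟨s, ?_⟩⟩
      fin_cases s <;> simp [star, Edge.shrink, hi]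

/-! ### Comparing the vertices obtained from different insertions -/

/-- The colorings that come from an insertion of the third color. -/
def Inserted (p : ℕ) : Set PathColoring := {a | a 2 p ≠ a 2 (p + 2)}

theorem VerticesOnly.exists_realOn_inserted {n : Fin 3 → ℕ} (h : VerticesOnly n) {p : ℕ}
    (hp : p + 1 < n 2) {F : PathColoring → Fin 3 → Fin 3} (hF : Virtual (grow n) F) :
    ∃ w : Vertex, w.Mem (grow n) ∧ RealOn (grow n) (Inserted p) F w := by
  obtain ⟨w, hw, τ, hτ⟩ := h _ (hF.insertAt hp)
  obtain ⟨w', hw', hs⟩ := exists_shrink_star_eq hp hw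
  choose f hf using hs
  refine ⟨w', hw', τ ∘ f, fun s b hb hbv => ?_⟩
  obtain ⟨a, ha, rfl⟩ := exists_insertAt_eq hbv hp hb
  rw [color_insertAt, hf]
  exact hτ (f s) a trivial ha

/-- Replace the first edge of a path by four edges, the first of which keeps the color. -/
def prepend (y₁ y₂ y₃ : Fin 3) (x : ℕ → Fin 3) : ℕ → Fin 3 := fun j =>
  if j = 0 then x 0 else if j = 1 then y₁ else if j = 2 then y₂ else if j = 3 then y₃ else x (j - 3)

theorem Valid.prepend {n : Fin 3 → ℕ} {a : PathColoring} (ha : Valid n a) (hn : 2 ≤ n 2)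
    {y₁ y₂ y₃ : Fin 3} (h₀ : a 2 0 ≠ y₁) (h₁ : y₁ ≠ y₂) (h₂ : y₂ ≠ y₃) (h₃ : y₃ ≠ a 2 1) :
    Valid (grow (grow (grow n))) (CubicTheta.setPath a (CubicTheta.prepend y₁ y₂ y₃ (a 2))) := by
  refine ha.setPath (fun i hi => by simp only [grow_of_ne _ hi]) (fun j hj => ?_) ?_ ?_
  · simp only [grow_two] at hj
    rcases j with _ | _ | _ | _ | j
    · simpa [CubicTheta.prepend] using h₀
    · simpa [CubicTheta.prepend] using h₁
    · simpa [CubicTheta.prepend] using h₂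
    · simpa [CubicTheta.prepend] using h₃
    · have := ha.step 2 (j + 1) (by omega)
      simpa [CubicTheta.prepend] using this
  · simp [CubicTheta.prepend]
  · simp only [grow_two, CubicTheta.prepend]
    rw [if_neg (by omega), if_neg (by omega), if_neg (by omega), if_neg (by omega)]
    congr 1

/-- A coloring of the graph with path `2` longer by three that has the colors
`x, y, z, x, y` on the first five edges. -/
def extend (a : PathColoring) : PathColoring :=
  setPath a (prepend (a 2 1) (third (a 2 0) (a 2 1)) (a 2 0) (a 2))

theorem Valid.extend {n : Fin 3 → ℕ} {a : PathColoring} (ha : Valid n a) (hn : 2 ≤ n 2) :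
    Valid (grow (grow (grow n))) (CubicTheta.extend a) := by
  have h := ha.step 2 0 hn
  exact ha.prepend hn h (third_ne_right h).symm (third_ne_left h) h

/-- In `x, y, z, x, y` any three consecutive colors are different. -/
theorem extend_mem {n : Fin 3 → ℕ} {a : PathColoring} (ha : Valid n a) (hn : 2 ≤ n 2) {p : ℕ}
    (hp : p < 3) : extend a ∈ Inserted p := by
  have h := ha.step 2 0 hn
  have h1 := third_ne_left h
  have h2 := third_ne_right h
  interval_cases p <;> simp only [Inserted, Set.mem_ofPred_eq, extend, setPath_two, prepend] <;>
    simp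
  exacts [h1.symm, h.symm, h2]

/-- The vertex of the graph with path `2` shorter by three that corresponds to `w` under
`extend`. -/
def Vertex.collapse : Vertex → Vertex
  | .first => .first
  | .last => .last
  | .inner i j => if i = 2 then .inner 2 (j - 3) else .inner i j

/-- The edges at a vertex `w`, in an order such that they correspond to those at `w.collapse` under
`extend`. -/
def collapseStar (n : Fin 3 → ℕ) : Vertex → Fin 3 → Edge
  | .first => star n .first
  | .last => star n .last
  | .inner i j => if i = 2 then
      match j with
      | 0 => ![.path 2 0, .path 2 1, .half 2 0]
      | 1 => ![.half 2 1, .path 2 1, .path 2 2]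
      | 2 => ![.path 2 3, .half 2 2, .path 2 2]
      | 3 => ![.path 2 3, .path 2 4, .half 2 3]
      | j + 4 => star n (.inner 2 (j + 4))
    else star n (.inner i j)

theorem exists_collapseStar_eq (n : Fin 3 → ℕ) (w : Vertex) :
    ∃ σ : Equiv.Perm (Fin 3), ∀ s, collapseStar n w s = star n w (σ s) := by
  cases w with
  | first => exact ⟨1, fun s => rfl⟩
  | last => exact ⟨1, fun s => rfl⟩
  | inner i j =>
    by_cases hi : i = 2
    · subst hi
      rcases j with _ | _ | _ | _ | j
      · exact ⟨1, fun s => by fin_cases s <;> rfl⟩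
      · exact ⟨Equiv.addRight 2, fun s => by fin_cases s <;> rfl⟩
      · exact ⟨Equiv.addRight 1, fun s => by fin_cases s <;> rfl⟩
      · exact ⟨1, fun s => by fin_cases s <;> rfl⟩
      · exact ⟨1, fun s => rfl⟩
    · exact ⟨1, fun s => by simp [collapseStar, hi]⟩

theorem Vertex.Mem.collapse {n : Fin 3 → ℕ} (hn : 2 ≤ n 2) {w : Vertex}
    (hw : w.Mem (grow (grow (grow n)))) : w.collapse.Mem n := by
  cases w with
  | first => trivial
  | last => trivial
  | inner i j =>
    by_cases hi : i = 2
    · subst hi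
      simp only [Vertex.Mem, grow_two] at hw
      simp only [Vertex.collapse, if_true, Vertex.Mem]
      omega
    · simpa only [Vertex.Mem, Vertex.collapse, if_neg hi, grow_of_ne _ hi] using hw

theorem Vertex.eq_or_of_collapse_eq {u w : Vertex} (h : u.collapse = w.collapse) :
    u = w ∨ ∃ j < 4, ∃ k < 4, u = .inner 2 j ∧ w = .inner 2 k := by
  rcases u with _ | _ | ⟨i, j⟩ <;> rcases w with _ | _ | ⟨i', j'⟩ <;>
    simp only [Vertex.collapse] at h
  · exact Or.inl rfl
  · exact absurd h (by simp)
  · split_ifs at h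
  · exact absurd h (by simp)
  · exact Or.inl rfl
  · split_ifs at h
  · split_ifs at h
  · split_ifs at h
  · split_ifs at h with hi hi' hi' <;> rw [Vertex.inner.injEq] at h
    · subst hi hi'
      by_cases hj : j = j'
      · exact Or.inl (by rw [hj])
      · exact Or.inr ⟨j, by omega, j', by omega, rfl, rfl⟩
    · exact absurd h.1.symm hi'
    · exact absurd h.1 hi
    · exact Or.inl (by rw [h.1, h.2])

/-- Along `x, y, z, x, y` the half-edges have colors `z, x, y, z`. `collapseStar` lists the edges at
each of these four vertices in the order `x, y, z`, as at the first inner vertex of the short path.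
-/
theorem color_extend (n : Fin 3 → ℕ) (hn : 2 ≤ n 2) (a : PathColoring) (w : Vertex) (s : Fin 3) :
    color (extend a) (collapseStar (grow (grow (grow n))) w s) =
      color a (star n w.collapse s) := by
  have hne : ∀ {i}, i ≠ 2 → extend a i = a i := fun hi => setPath_of_ne _ _ hi
  have h2 : extend a 2 = prepend (a 2 1) (third (a 2 0) (a 2 1)) (a 2 0) (a 2) := setPath_two _ _
  cases w with
  | first =>
    by_cases hs : s = 2
    · subst hs; simp [collapseStar, star, color, h2, prepend, Vertex.collapse]
    · simp [collapseStar, star, color, hne hs, Vertex.collapse]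
  | last =>
    by_cases hs : s = 2
    · subst hs
      simp only [collapseStar, star, color, h2, prepend, Vertex.collapse, grow_two]
      rw [if_neg (by omega), if_neg (by omega), if_neg (by omega), if_neg (by omega)]
      congr 1
    · simp [collapseStar, star, color, hne hs, Vertex.collapse, grow_of_ne _ hs]
  | inner i j =>
    by_cases hi : i = 2
    · subst hi
      have h3 : third (a 2 1) (third (a 2 0) (a 2 1)) = a 2 0 := by
        rw [third_comm (a 2 0), third_third_right]
      have h4 : third (third (a 2 0) (a 2 1)) (a 2 0) = a 2 1 := third_third_left
      rcases j with _ | _ | _ | _ | j <;> fin_cases s <;>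
        simp [collapseStar, star, color, h2, prepend, Vertex.collapse, h3, h4]
    · simp only [collapseStar, Vertex.collapse, if_neg hi]
      fin_cases s <;> simp [star, color, hne hi]

/-- In the shorter graph, a vertex is determined by the colors at it. -/
theorem Separated.vertex_eq {n : Fin 3 → ℕ} (h : Separated n) (hn : ∀ i, 1 ≤ n i) (hn2 : 2 ≤ n 2)
    {u w : Vertex} (hu : u.Mem n) (hw : w.Mem n)
    (huw : ∀ s, ∃ s', ∀ a, Valid n a → color a (star n u s) = color a (star n w s')) : u = w := by
  have hstar : ∀ s, ∃ s', star n u s = star n w s' := by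
    intro s
    obtain ⟨s', hs'⟩ := huw s
    refine ⟨s', ?_⟩
    by_contra hne
    obtain ⟨a, ha, hc⟩ := h _ _ (star_mem hn hu s) (star_mem hn hw s') hne
    exact hc (hs' a ha)
  have half : ∀ i j, u = .inner i j → u = w := by
    rintro i j rfl
    obtain ⟨s', hs'⟩ := hstar 2
    cases w with
    | first => simp [star] at hs'
    | last => simp [star] at hs'
    | inner i' j' => fin_cases s' <;> simp_all [star]
  have hother : ∀ i : Fin 3, ∃ s : Fin 3, s ≠ i := fun i => ⟨i + 1, by revert i; decide⟩
  cases hu' : u with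
  | inner i j => rw [← hu']; exact half i j hu'
  | first =>
    subst hu'
    cases w with
    | first => rfl
    | last =>
      obtain ⟨s', hs'⟩ := hstar 2
      simp only [star, Edge.path.injEq] at hs'
      obtain ⟨rfl, hs'⟩ := hs'
      omega
    | inner i j =>
      obtain ⟨s, hs⟩ := hother i
      obtain ⟨s', hs'⟩ := hstar s
      fin_cases s' <;> simp_all [star]
  | last =>
    subst hu'
    cases w with
    | last => rfl
    | first =>
      obtain ⟨s', hs'⟩ := hstar 2
      simp only [star, Edge.path.injEq] at hs'
      obtain ⟨rfl, hs'⟩ := hs'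
      omega
    | inner i j =>
      obtain ⟨s, hs⟩ := hother i
      obtain ⟨s', hs'⟩ := hstar s
      fin_cases s' <;> simp_all [star]

theorem Valid.third_eq_of_mem_inserted {n : Fin 3 → ℕ} {b : PathColoring} (hb : Valid n b) {p : ℕ}
    (hp : p + 2 < n 2) (h : b ∈ Inserted p) :
    third (b 2 p) (b 2 (p + 1)) = b 2 (p + 2) ∧ third (b 2 (p + 1)) (b 2 (p + 2)) = b 2 p := by
  have h1 := hb.step 2 p (by omega)
  have h2 := hb.step 2 (p + 1) (by omega)
  exact ⟨(eq_third h1 (Ne.symm h) h2.symm).symm, (eq_third h2 h1 h).symm⟩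

/-- When edges `p, p + 1, p + 2` have three different colors, the half-edge at each of the two
vertices between them repeats the color of the far path edge. Thus neighboring vertices cannot be
distinguished on `Inserted p`. -/
theorem color_collapseStar_succ {n : Fin 3 → ℕ} (hn : 5 ≤ n 2) {b : PathColoring} (hb : Valid n b)
    {p : ℕ} (hp : p < 3) (h : b ∈ Inserted p) (s : Fin 3) :
    color b (collapseStar n (.inner 2 p) s) = color b (collapseStar n (.inner 2 (p + 1)) s) := by
  obtain ⟨h1, h2⟩ := hb.third_eq_of_mem_inserted (by omega) h
  interval_cases p <;> fin_cases s <;> simp_all [collapseStar, color]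

/-- If a 3-coloring of the coloring complex comes from the same vertex for all colorings to which
an insertion applies, then it comes from that vertex. -/
theorem Virtual.realOn_univ {n : Fin 3 → ℕ} (hn : ∀ i, 1 ≤ n i) (hn2 : 5 ≤ n 2)
    {F : PathColoring → Fin 3 → Fin 3} (hF : Virtual n F) {w : Vertex} (hw : w.Mem n)
    {τ : Fin 3 → Fin 3} (hτ : Function.Injective τ)
    (h : ∀ p < 3, ∀ s, ∀ b ∈ Inserted p, Valid n b → F b (color b (star n w s)) = τ s) :
    RealOn n Set.univ F w := by
  refine ⟨τ, fun s b _ hb => ?_⟩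
  by_cases hD : ∃ p < 3, b ∈ Inserted p
  · obtain ⟨p, hp, hD⟩ := hD
    exact h p hp s b hD hb
  push Not at hD
  have e0 : b 2 0 = b 2 2 := not_not.1 (hD 0 (by decide))
  have e1 : b 2 1 = b 2 3 := not_not.1 (hD 1 (by decide))
  have e2 : b 2 2 = b 2 4 := not_not.1 (hD 2 (by decide))
  have hxy := hb.step 2 0 (by omega)
  set x := b 2 0 with hx
  set y := b 2 1 with hy
  have hzx := third_ne_left hxy
  have hzy := third_ne_right hxy
  -- The path now begins with `x, y, x, y, x`. Edge 1 or 2 has equally colored neighbors, so it can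
  -- be given the third color; this leaves the class of the other one of `x, y` unchanged. These
  -- edges are not last because the path has at least five edges.
  have hmod : ∀ q ∈ ({1, 2} : Set ℕ), ∀ v, b 2 q ≠ v →
      Valid n (setPath b (Function.update (b 2) q (third x y))) ∧
      ((v = x ∨ v = y) → ∀ i j, j < n i →
        (b i j = v ↔ setPath b (Function.update (b 2) q (third x y)) i j = v)) := by
    intro q hq v hv
    have hval : Valid n (setPath b (Function.update (b 2) q (third x y))) := by
      refine hb.setPath (fun i _ => rfl) (fun j hj => ?_) ?_ ?_
      · have hstep := hb.step 2 j hj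
        rcases hq with rfl | rfl
        · rcases j with _ | _ | j
          · simpa using hzx.symm
          · simpa [← e0] using hzx
          · simpa [Function.update] using hstep
        · rcases j with _ | _ | _ | j
          · simpa [Function.update] using hstep
          · simpa using hzy.symm
          · simpa [← e1] using hzy
          · simpa [Function.update] using hstep
      · rcases hq with rfl | rfl <;> simp
      · rw [Function.update_of_ne]
        rcases hq with rfl | rfl <;> omega
    refine ⟨hval, fun hvxy i j hj => ?_⟩
    by_cases hi : i = 2
    · subst hi
      rw [setPath_two]
      by_cases hjq : j = q
      · subst hjq
        rw [Function.update_self]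
        refine iff_of_false hv ?_
        rcases hvxy with rfl | rfl
        exacts [hzx, hzy]
      · rw [Function.update_of_ne hjq]
    · rw [setPath_of_ne _ _ hi]
  have key : ∀ v, v = x ∨ v = y → ∀ s, color b (star n w s) = v → F b v = τ s := by
    intro v hv s hs
    -- To keep the class of `x`, pass to `x, z, x, y, x`, where edges 1 and 3 differ; to keep that
    -- of `y`, pass to `x, y, z, y, x`, where edges 0 and 2 differ.
    obtain ⟨q, hq, hqv, p, hp, hmem⟩ : ∃ q ∈ ({1, 2} : Set ℕ), b 2 q ≠ v ∧ ∃ p < 3,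
        setPath b (Function.update (b 2) q (third x y)) ∈ Inserted p := by
      rcases hv with rfl | rfl
      · refine ⟨1, by simp, hxy.symm, 1, by decide, ?_⟩
        show setPath b _ 2 1 ≠ setPath b _ 2 3
        simpa [← e1] using hzy
      · refine ⟨2, by simp, by rw [← e0]; exact hxy, 0, by decide, ?_⟩
        show setPath b _ 2 0 ≠ setPath b _ 2 2
        simpa using hzx.symm
    obtain ⟨hval, hcls⟩ := hmod q hq v hqv
    have hc := (color_eq_iff_of_path hb hval (hcls hv) (star_mem hn hw s)).1 hs
    rw [hF.local_eq _ _ hb hval _ _ (hcls hv), ← h p hp s _ hmem hval, hc]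
  have hinj := hb.color_star_injective hw
  obtain ⟨s₁, hs₁⟩ := Finite.injective_iff_surjective.1 hinj x
  obtain ⟨s₂, hs₂⟩ := Finite.injective_iff_surjective.1 hinj y
  dsimp only at hs₁ hs₂
  by_cases h1 : s = s₁
  · rw [h1, hs₁]; exact key x (Or.inl rfl) _ hs₁
  by_cases h2 : s = s₂
  · rw [h2, hs₂]; exact key y (Or.inr rfl) _ hs₂
  have k1 := key x (Or.inl rfl) _ hs₁
  have k2 := key y (Or.inr rfl) _ hs₂
  have n12 : τ s₁ ≠ τ s₂ := by
    rw [← k1, ← k2]; exact (hF.injective b hb).ne hxy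
  have n1 : F b (color b (star n w s)) ≠ τ s₁ := by
    rw [← k1, ← hs₁]; exact (hF.injective b hb).ne (hinj.ne h1)
  have n2 : F b (color b (star n w s)) ≠ τ s₂ := by
    rw [← k2, ← hs₂]; exact (hF.injective b hb).ne (hinj.ne h2)
  -- The class of the third color gets the one label left over.
  rw [eq_third n12 n1 n2, ← eq_third n12 (hτ.ne h1) (hτ.ne h2)]

/-- Three insertion positions give vertices `u 0`, `u 1`, `u 2`. Separation three steps down aligns
them up to the first four inner vertices, and separation two steps down supplies the coloring that
relates `u 0` to `u 2`. -/
theorem VerticesOnly.grow {n : Fin 3 → ℕ} (hn : ∀ i, 1 ≤ n i) (hn2 : 2 ≤ n 2) (hs : Separated n)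
    (hs' : Separated (grow n)) (hv : VerticesOnly (grow (grow n))) :
    VerticesOnly (grow (grow (grow n))) := by
  intro F hF
  set N := CubicTheta.grow (CubicTheta.grow (CubicTheta.grow n)) with hN
  have hN2 : N 2 = n 2 + 3 := by simp [hN]
  have hN1 : ∀ i, 1 ≤ N i := by
    intro i
    by_cases hi : i = 2
    · subst hi; omega
    · simpa only [hN, grow_of_ne _ hi] using hn i
  obtain ⟨a₀, ha₀⟩ := hs.exists_valid hn
  have hreal : ∀ p < 3, ∃ u : Vertex, u.Mem N ∧ ∃ T : Fin 3 → Fin 3, ∀ s, ∀ b ∈ Inserted p,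
      Valid N b → F b (color b (collapseStar N u s)) = T s := by
    intro p hp
    obtain ⟨u, hu, τ, hτ⟩ := hv.exists_realOn_inserted (p := p)
      (by simp only [grow_two]; omega) hF
    obtain ⟨σ, hσ⟩ := exists_collapseStar_eq N u
    exact ⟨u, hu, τ ∘ σ, fun s b hb hbv => by rw [hσ]; exact hτ _ b hb hbv⟩
  have : Nonempty Vertex := ⟨.first⟩
  choose! u hu T hT using hreal
  have hinj : ∀ w : Vertex, w.Mem N → ∀ b, Valid N b →
      Function.Injective fun s => F b (color b (collapseStar N w s)) := by
    intro w hw b hb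
    obtain ⟨σ, hσ⟩ := exists_collapseStar_eq N w
    simp only [hσ]
    exact (hF.injective b hb).comp ((hb.color_star_injective hw).comp σ.injective)
  have hext : ∀ p < 3, ∀ s a, Valid n a →
      F (extend a) (color a (star n (u p).collapse s)) = T p s := by
    intro p hp s a ha
    rw [← color_extend n hn2]
    exact hT p hp s _ (extend_mem ha hn2 hp) (ha.extend hn2)
  have hTinj : ∀ p < 3, Function.Injective (T p) := by
    intro p hp
    have := hinj _ (hu p hp) _ (ha₀.extend hn2)
    rwa [show (fun s => F (extend a₀) (color (extend a₀) (collapseStar N (u p) s))) = T p from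
      funext fun s => hT p hp s _ (extend_mem ha₀ hn2 hp) (ha₀.extend hn2)] at this
  -- All three vertices describe `F` on the extended colorings, so after collapsing they see the
  -- same colors in every coloring of the short graph.
  have hcollapse : ∀ p < 3, (u p).collapse = (u 0).collapse := by
    intro p hp
    refine hs.vertex_eq hn hn2 ((hu p hp).collapse hn2) ((hu 0 (by decide)).collapse hn2)
      fun s => ?_
    obtain ⟨s', hs'⟩ := Finite.injective_iff_surjective.1 (hTinj 0 (by decide)) (T p s)
    exact ⟨s', fun a ha => hF.injective _ (ha.extend hn2)
      ((hext p hp s a ha).trans (hs'.symm.trans (hext 0 (by decide) s' a ha).symm))⟩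
  have hTeq : ∀ p < 3, T p = T 0 := by
    intro p hp
    funext s
    rw [← hext p hp s a₀ ha₀, hcollapse p hp, hext 0 (by decide) s a₀ ha₀]
  suffices ∃ w : Vertex, w.Mem N ∧ ∀ p < 3, ∀ s, ∀ b ∈ Inserted p, Valid N b →
      F b (color b (collapseStar N w s)) = T 0 s by
    obtain ⟨w, hw, h⟩ := this
    obtain ⟨σ, hσ⟩ := exists_collapseStar_eq N w
    refine ⟨w, hw, hF.realOn_univ hN1 (by omega) hw
      ((hTinj 0 (by decide)).comp σ.symm.injective) fun p hp s b hb hbv => ?_⟩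
    rw [Function.comp_apply, ← h p hp _ b hb hbv, hσ, σ.apply_symm_apply]
  have hT' : ∀ p < 3, ∀ s, ∀ b ∈ Inserted p, Valid N b →
      F b (color b (collapseStar N (u p) s)) = T 0 s := fun p hp => hTeq p hp ▸ hT p hp
  by_cases hall : ∀ p < 3, u p = u 0
  · exact ⟨u 0, hu 0 (by decide), fun p hp => by
      have := hT' p hp
      rwa [hall p hp] at this⟩
  have hloc : ∀ p < 3, ∃ k < 4, u p = .inner 2 k := by
    push Not at hall
    obtain ⟨q, hq, hne⟩ := hall
    obtain ⟨j, -, k, hk, -, h0⟩ := (Vertex.eq_or_of_collapse_eq (hcollapse q hq)).resolve_left hne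
    intro p hp
    rcases Vertex.eq_or_of_collapse_eq (hcollapse p hp) with h | ⟨j, hj, k, hk, h, -⟩
    · exact ⟨k, hk, h.trans h0⟩
    · exact ⟨j, hj, h⟩
  choose! k hk huk using hloc
  have hsame : ∀ p < 3, ∀ q < 3, ∀ s, ∀ b ∈ Inserted p, b ∈ Inserted q → Valid N b →
      color b (collapseStar N (.inner 2 (k p)) s) = color b (collapseStar N (.inner 2 (k q)) s) := by
    intro p hp q hq s b hbp hbq hb
    rw [← huk p hp, ← huk q hq]
    exact hF.injective b hb ((hT' p hp s b hbp hb).trans (hT' q hq s b hbq hb).symm)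
  have hstep : ∀ p < 3, ∀ s, ∀ b ∈ Inserted p, Valid N b →
      color b (collapseStar N (.inner 2 p) s) = color b (collapseStar N (.inner 2 (p + 1)) s) :=
    fun p hp s b hb hbv => color_collapseStar_succ (by omega) hbv hp hb s
  have hk0 := hk 0 (by decide)
  have hk1 := hk 1 (by decide)
  have hk2 := hk 2 (by decide)
  have h01 := ha₀.step 2 0 (by omega)
  have hz0 := third_ne_left h01
  have hz1 := third_ne_right h01
  have h3 : third (a₀ 2 1) (third (a₀ 2 0) (a₀ 2 1)) = a₀ 2 0 := by
    rw [third_comm (a₀ 2 0), third_third_right]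
  have h4 : third (third (a₀ 2 0) (a₀ 2 1)) (a₀ 2 0) = a₀ 2 1 := third_third_left
  -- The path begins with `x, z, y, x, y`, which lies in the images for 0 and 1. The edge in
  -- position 1 has color `z` at the inner vertices 0, 1, 2 and `y` at 3.
  have c01 : k 0 = 3 ↔ k 1 = 3 := by
    have hb := ha₀.prepend hn2 (y₁ := third (a₀ 2 0) (a₀ 2 1)) (y₂ := a₀ 2 1) (y₃ := a₀ 2 0)
      hz0.symm hz1 h01.symm h01
    have h := hsame 0 (by decide) 1 (by decide) 1 _
      (by simp [Inserted, prepend, h01]) (by simp [Inserted, prepend, hz0]) hb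
    have hβ : ∀ j < 4, color (setPath a₀ (prepend (third (a₀ 2 0) (a₀ 2 1)) (a₀ 2 1) (a₀ 2 0)
        (a₀ 2))) (collapseStar N (.inner 2 j) 1) =
        if j = 3 then a₀ 2 1 else third (a₀ 2 0) (a₀ 2 1) := by
      intro j hj
      interval_cases j <;> simp [collapseStar, color, prepend, third_comm]
    rw [hβ _ hk0, hβ _ hk1] at h
    split_ifs at h with h1 h2 h2
    · simp [h1, h2]
    · exact absurd h hz1.symm
    · exact absurd h hz1
    · simp [h1, h2]
  -- The mirrored pattern `x, y, x, z, y` lies in the images for 1 and 2. Position 0 has color `x`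
  -- at the inner vertex 0 and `z` at 1, 2, 3.
  have c12 : k 1 = 0 ↔ k 2 = 0 := by
    have hb := ha₀.prepend hn2 (y₁ := a₀ 2 1) (y₂ := a₀ 2 0) (y₃ := third (a₀ 2 0) (a₀ 2 1))
      h01 h01.symm hz0.symm hz1
    have h := hsame 1 (by decide) 2 (by decide) 0 _
      (by simp [Inserted, prepend, hz1.symm]) (by simp [Inserted, prepend, h01]) hb
    have hα : ∀ j < 4, color (setPath a₀ (prepend (a₀ 2 1) (a₀ 2 0) (third (a₀ 2 0) (a₀ 2 1))
        (a₀ 2))) (collapseStar N (.inner 2 j) 0) =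
        if j = 0 then a₀ 2 0 else third (a₀ 2 0) (a₀ 2 1) := by
      intro j hj
      interval_cases j <;> simp [collapseStar, color, prepend, third_comm]
    rw [hα _ hk1, hα _ hk2] at h
    split_ifs at h with h1 h2 h2
    · simp [h1, h2]
    · exact absurd h hz0.symm
    · exact absurd h hz0
    · simp [h1, h2]
  -- The chosen edges have different colors only if the path begins with `x, y, x`. Two insertions
  -- turn this into `x, z, y, z, x`, in the images for 0 and 2; position 0 has color `x` at the
  -- inner vertices 0, 1 and `z` at 2, 3.
  have c02 : k 0 ≤ 1 ↔ k 2 ≤ 1 := by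
    obtain ⟨a, ha, hac⟩ := hs' (.path 2 0) (.half 2 1) (by simp [Edge.Mem])
      (by simp only [Edge.Mem, grow_two]; omega) (by simp)
    simp only [color] at hac
    have hb1 := ha.insertAt (p := 1) (by rw [grow_two]; omega)
    have hb := hb1.insertAt (p := 0) (by simp only [grow_two]; omega)
    have s0 := ha.step 2 0 (by rw [grow_two]; omega)
    have s1 := ha.step 2 1 (by rw [grow_two]; omega)
    set b := insertAt 0 (insertAt 1 a) with hbdef
    have b0 : b 2 0 = a 2 0 := by simp [hbdef, insertAt, insertThird]
    have b2 : b 2 2 = a 2 1 := by simp [hbdef, insertAt, insertThird]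
    have b3 : b 2 3 = third (a 2 1) (a 2 2) := by simp [hbdef, insertAt, insertThird]
    have b4 : b 2 4 = a 2 2 := by simp [hbdef, insertAt, insertThird]
    have m0 : b ∈ Inserted 0 := by
      show b 2 0 ≠ b 2 2
      rw [b0, b2]; exact s0
    have m2 : b ∈ Inserted 2 := by
      show b 2 2 ≠ b 2 4
      rw [b2, b4]; exact s1
    have h := hsame 0 (by decide) 2 (by decide) 0 b m0 m2 hb
    have hα : ∀ j < 4, color b (collapseStar N (.inner 2 j) 0) =
        if j ≤ 1 then b 2 0 else b 2 3 := by
      intro j hj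
      have := (hb.third_eq_of_mem_inserted (p := 0) (by simp only [grow_two]; omega) m0).2
      interval_cases j
      · rfl
      · exact this
      · rfl
      · rfl
    have hne : b 2 0 ≠ b 2 3 := by rw [b0, b3]; exact hac
    rw [hα _ hk0, hα _ hk2] at h
    split_ifs at h with h1 h2 h2
    · simp [h1, h2]
    · exact absurd h hne
    · exact absurd h hne.symm
    · simp [h1, h2]
  -- For each `p` the vertex `k p` may be replaced within the pair `p, p + 1`. The three
  -- equivalences ensure that some `w` is reachable from all `k p` in this way.
  obtain ⟨w, hw4, hw⟩ : ∃ w < 4, ∀ p < 3, w = k p ∨ (w = p ∧ k p = p + 1) ∨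
      (w = p + 1 ∧ k p = p) := by
    have : ∀ w, (∀ p < 3, w = k p ∨ (w = p ∧ k p = p + 1) ∨ (w = p + 1 ∧ k p = p)) ↔
        (w = k 0 ∨ (w = 0 ∧ k 0 = 1) ∨ (w = 1 ∧ k 0 = 0)) ∧
        (w = k 1 ∨ (w = 1 ∧ k 1 = 2) ∨ (w = 2 ∧ k 1 = 1)) ∧
        (w = k 2 ∨ (w = 2 ∧ k 2 = 3) ∨ (w = 3 ∧ k 2 = 2)) := by
      intro w
      constructor
      · intro h
        exact ⟨h 0 (by decide), h 1 (by decide), h 2 (by decide)⟩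
      · rintro ⟨h0, h1, h2⟩ p hp
        interval_cases p
        exacts [h0, h1, h2]
    simp only [this]
    generalize k 0 = k0 at *
    generalize k 1 = k1 at *
    generalize k 2 = k2 at *
    interval_cases k1
    · exact ⟨0, by omega⟩
    · by_cases h : k0 ≤ 1
      · exact ⟨1, by omega⟩
      · exact ⟨2, by omega⟩
    · by_cases h : k0 ≤ 1
      · exact ⟨1, by omega⟩
      · exact ⟨2, by omega⟩
    · exact ⟨3, by omega⟩
  refine ⟨.inner 2 w, by simp only [Vertex.Mem]; omega, fun p hp s b hb hbv => ?_⟩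
  have hTp := hT' p hp s b hb hbv
  rw [huk p hp] at hTp
  rcases hw p hp with h | ⟨rfl, h⟩ | ⟨rfl, h⟩
  · rw [h]; exact hTp
  · rw [hstep w hp s b hb hbv, ← h]; exact hTp
  · rw [← hstep p hp s b hb hbv]
    rwa [h] at hTp

/-! ### The classification -/

theorem grow_cons (k l m : ℕ) : grow ![k, l, m] = ![k, l, m + 1] := by
  funext i; fin_cases i <;> rfl

theorem Separated.swap_left {k l m : ℕ} (h : Separated ![k, l, m]) : Separated ![l, k, m] := by
  have := h.perm (Equiv.swap 0 1)
  rwa [show ![k, l, m] ∘ Equiv.swap 0 1 = ![l, k, m] by funext i; fin_cases i <;> rfl] at this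

theorem Separated.swap_right {k l m : ℕ} (h : Separated ![k, l, m]) : Separated ![k, m, l] := by
  have := h.perm (Equiv.swap 1 2)
  rwa [show ![k, l, m] ∘ Equiv.swap 1 2 = ![k, m, l] by funext i; fin_cases i <;> rfl] at this

theorem VerticesOnly.swap_left {k l m : ℕ} (h : VerticesOnly ![k, l, m]) :
    VerticesOnly ![l, k, m] := by
  have := h.perm (Equiv.swap 0 1)
  rwa [show ![k, l, m] ∘ Equiv.swap 0 1 = ![l, k, m] by funext i; fin_cases i <;> rfl] at this

theorem VerticesOnly.swap_right {k l m : ℕ} (h : VerticesOnly ![k, l, m]) :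
    VerticesOnly ![k, m, l] := by
  have := h.perm (Equiv.swap 1 2)
  rwa [show ![k, l, m] ∘ Equiv.swap 1 2 = ![k, m, l] by funext i; fin_cases i <;> rfl] at this

theorem Reflexive.swap_left {k l m : ℕ} (h : Reflexive k l m) : Reflexive l k m :=
  ⟨h.1.swap_left, h.2.swap_left⟩

theorem Reflexive.swap_right {k l m : ℕ} (h : Reflexive k l m) : Reflexive k m l :=
  ⟨h.1.swap_right, h.2.swap_right⟩

theorem Separated.of_min {k l m : ℕ} (h : Separated ![k, l, min m 3]) : Separated ![k, l, m] := by
  rcases le_total m 3 with hm | hm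
  · rwa [min_eq_left hm] at h
  · rw [min_eq_right hm] at h
    induction m, hm using Nat.le_induction with
    | base => exact h
    | succ m hm ih => exact grow_cons k l m ▸ ih.grow hm

/-- Lengthening preserves separation from length 3 on, so lengths may be truncated at 3 and finitely
many cases remain. -/
theorem separated_of_min {k l m : ℕ} (h : Separated ![min k 3, min l 3, min m 3]) :
    Separated ![k, l, m] :=
  h.of_min.swap_right.of_min.swap_left.swap_right.of_min.swap_right.swap_left.swap_right

theorem separated_of_two_le {k l m : ℕ} (hk : 2 ≤ k) (hl : 2 ≤ l) (hm : 2 ≤ m) :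
    Separated ![k, l, m] := by
  apply separated_of_min
  have h : ∀ x, 2 ≤ x → min x 3 = 2 ∨ min x 3 = 3 := fun x hx => by omega
  rcases h k hk with h1 | h1 <;> rcases h l hl with h2 | h2 <;> rcases h m hm with h3 | h3 <;>
    rw [h1, h2, h3]
  · exact separated_2_2_2
  · exact separated_2_2_3
  · exact separated_2_2_3.swap_right
  · exact separated_2_3_3
  · exact separated_2_2_3.swap_right.swap_left
  · exact separated_2_3_3.swap_left
  · exact separated_2_3_3.swap_left.swap_right
  · exact separated_3_3_3

theorem separated_one_of_three_le {l m : ℕ} (hl : 3 ≤ l) (hm : 3 ≤ m) : Separated ![1, l, m] := by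
  apply separated_of_min
  rw [min_eq_right hl, min_eq_right hm]
  exact separated_1_3_3

theorem VerticesOnly.succ {k l r : ℕ} (hk : 1 ≤ k) (hl : 1 ≤ l) (hr : 2 ≤ r)
    (hs : Separated ![k, l, r]) (hs' : Separated ![k, l, r + 1])
    (hv : VerticesOnly ![k, l, r + 2]) : VerticesOnly ![k, l, r + 3] := by
  rw [← grow_cons, ← grow_cons, ← grow_cons]
  refine VerticesOnly.grow ?_ hr hs (grow_cons k l r ▸ hs') ?_
  · intro i
    fin_cases i
    exacts [hk, hl, (by decide : 1 ≤ 2).trans hr]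
  · rwa [grow_cons, grow_cons]

/-- The nondecreasing triples of path lengths of edge-reflexive cubic theta graphs. -/
def Good (k l m : ℕ) : Prop :=
  k = 1 ∧ l = 1 ∧ m = 1 ∨ k = 1 ∧ 3 ≤ l ∨ k = 2 ∧ l ≤ 3 ∧ 5 ≤ m ∨ k = 2 ∧ 4 ≤ l ∨
    k = 3 ∧ 4 ≤ m ∨ 4 ≤ k

theorem Good.separated {k l m : ℕ} (h : Good k l m) (hkl : k ≤ l) (hlm : l ≤ m) :
    Separated ![k, l, m] := by
  unfold Good at h
  by_cases hm : m = 1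
  · obtain ⟨rfl, rfl, rfl⟩ : k = 1 ∧ l = 1 ∧ m = 1 := by omega
    exact separated_1_1_1
  by_cases hk : k = 1
  · subst hk
    exact separated_one_of_three_le (by omega) (by omega)
  · exact separated_of_two_le (by omega) (by omega) (by omega)

theorem Good.verticesOnly_of_le_four {k l m : ℕ} (h : Good k l m) (hkl : k ≤ l) (hlm : l ≤ m)
    (hm : m ≤ 4) : VerticesOnly ![k, l, m] := by
  have hk : 1 ≤ k := by unfold Good at h; omega
  interval_cases m <;> interval_cases l <;> interval_cases k
  all_goals first
    | exact absurd h (by unfold Good; decide)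
    | skip
  exacts [verticesOnly_1_1_1, verticesOnly_1_3_3, verticesOnly_1_3_4, verticesOnly_3_3_4,
    verticesOnly_1_4_4, verticesOnly_2_4_4, verticesOnly_3_4_4, verticesOnly_4_4_4]

/-- Induction on the total length, shortening a longest path by one. Outside the searched cases the
shortened triple, sorted again, is still good. -/
theorem Good.verticesOnly {k l m : ℕ} (h : Good k l m) (hkl : k ≤ l) (hlm : l ≤ m) :
    VerticesOnly ![k, l, m] := by
  induction hN : k + l + m using Nat.strong_induction_on generalizing k l m with
  | _ N ih =>
    by_cases hm : m ≤ 4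
    · exact h.verticesOnly_of_le_four hkl hlm hm
    by_cases hm5 : m = 5 ∧ (k = 1 ∨ k = 2 ∧ l ≤ 3)
    · have : (k = 1 ∧ l = 3) ∨ (k = 1 ∧ l = 4) ∨ (k = 1 ∧ l = 5) ∨ (k = 2 ∧ l = 2) ∨
          (k = 2 ∧ l = 3) := by
        unfold Good at h
        grind
      obtain ⟨rfl, -⟩ := hm5
      rcases this with ⟨rfl, rfl⟩ | ⟨rfl, rfl⟩ | ⟨rfl, rfl⟩ | ⟨rfl, rfl⟩ | ⟨rfl, rfl⟩
      exacts [verticesOnly_1_3_5, verticesOnly_1_4_5, verticesOnly_1_5_5, verticesOnly_2_2_5,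
        verticesOnly_2_3_5]
    have h1 : l < m → Good k l (m - 1) := by unfold Good at *; grind
    have h2 : l = m → k < m → Good k (m - 1) l := by unfold Good at *; grind
    have h3 : l = m → k = m → Good (m - 1) k l := by unfold Good at *; grind
    -- With `k = 1`, separation is needed for the path of length `m - 3`, which must still be at
    -- least 3.
    have h4 : 2 ≤ k ∨ k = 1 ∧ 3 ≤ l ∧ 6 ≤ m := by unfold Good at *; grind
    obtain ⟨r, rfl⟩ : ∃ r, m = r + 3 := ⟨m - 3, by omega⟩
    have hsep : ∀ r', r ≤ r' → Separated ![k, l, r'] := by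
      intro r' hr
      rcases h4 with h4 | ⟨rfl, h4, h5⟩
      · exact separated_of_two_le (by omega) (by omega) (by omega)
      · exact separated_one_of_three_le h4 (by omega)
    refine VerticesOnly.succ (by omega) (by omega) (by omega) (hsep r le_rfl)
      (hsep _ (Nat.le_succ r)) ?_
    by_cases hl : l < r + 3
    · exact ih _ (by omega) (h1 hl) hkl (by omega) rfl
    by_cases hk : k < r + 3
    · exact (ih _ (by omega) (h2 (by omega) hk) (by omega) (by omega) rfl).swap_right
    · exact (ih _ (by omega) (h3 (by omega) (by omega)) (by omega) (by omega)
        rfl).swap_left.swap_right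

/-- Both end edges of the long path must have the color missing on the two single edges. -/
theorem not_separated_one_one {m : ℕ} (hm : 2 ≤ m) : ¬ Separated ![1, 1, m] := by
  intro h
  obtain ⟨a, ha, hc⟩ := h (.path 2 0) (.path 2 (m - 1)) (by show 0 < m; omega)
    (by show m - 1 < m; omega) (by simp; omega)
  have h1 : a 0 0 ≠ a 1 0 := ha.first.ne (by decide)
  have h2 := eq_third h1 (ha.first.ne (by decide : (2 : Fin 3) ≠ 0))
    (ha.first.ne (by decide : (2 : Fin 3) ≠ 1))
  have h3 := eq_third h1 (ha.last.ne (by decide : (2 : Fin 3) ≠ 0))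
    (ha.last.ne (by decide : (2 : Fin 3) ≠ 1))
  exact hc (h2.trans h3.symm)

/-- The single edge meets both edges of the path of length 2, so it always has the color of the
half-edge between them. -/
theorem not_separated_one_two (m : ℕ) : ¬ Separated ![1, 2, m] := by
  intro h
  obtain ⟨a, ha, hc⟩ := h (.path 0 0) (.half 1 0) (by show 0 < 1; omega)
    (by show 0 + 1 < 2; omega) (by simp)
  have h1 : a 1 0 ≠ a 1 1 := ha.step 1 0 (by show 0 + 1 < 2; omega)
  exact hc (eq_third h1 (ha.first.ne (by decide : (0 : Fin 3) ≠ 1))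
    (ha.last.ne (by decide : (0 : Fin 3) ≠ 1)))

theorem not_reflexive_of_not_good {k l m : ℕ} (hk : 1 ≤ k) (hkl : k ≤ l) (hlm : l ≤ m)
    (h : ¬ Good k l m) : ¬ Reflexive k l m := by
  have : (k = 1 ∧ l = 1 ∧ 2 ≤ m) ∨ (k = 1 ∧ l = 2) ∨ (k = 2 ∧ l = 2 ∧ m = 2) ∨
      (k = 2 ∧ l = 2 ∧ m = 3) ∨ (k = 2 ∧ l = 2 ∧ m = 4) ∨ (k = 2 ∧ l = 3 ∧ m = 3) ∨
      (k = 2 ∧ l = 3 ∧ m = 4) ∨ (k = 3 ∧ l = 3 ∧ m = 3) := by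
    unfold Good at h
    rcases Nat.lt_or_ge k 4 with hk4 | hk4
    · interval_cases k <;> simp at h ⊢ <;> omega
    · omega
  rintro ⟨hs, hv⟩
  rcases this with ⟨rfl, rfl, hm⟩ | ⟨rfl, rfl⟩ | ⟨rfl, rfl, rfl⟩ | ⟨rfl, rfl, rfl⟩ |
    ⟨rfl, rfl, rfl⟩ | ⟨rfl, rfl, rfl⟩ | ⟨rfl, rfl, rfl⟩ | ⟨rfl, rfl, rfl⟩
  exacts [not_separated_one_one hm hs, not_separated_one_two m hs, not_verticesOnly_2_2_2 hv,
    not_verticesOnly_2_2_3 hv, not_verticesOnly_2_2_4 hv, not_verticesOnly_2_3_3 hv,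
    not_verticesOnly_2_3_4 hv, not_verticesOnly_3_3_3 hv]

theorem reflexive_iff_good {k l m : ℕ} (hk : 1 ≤ k) (hkl : k ≤ l) (hlm : l ≤ m) :
    Reflexive k l m ↔ Good k l m :=
  ⟨fun h => by_contra fun hg => not_reflexive_of_not_good hk hkl hlm hg h,
    fun h => ⟨h.separated hkl hlm, h.verticesOnly hkl hlm⟩⟩

theorem multiset_triple_eq_iff {k l m x y z : ℕ} (hkl : k ≤ l) (hlm : l ≤ m) (hxy : x ≤ y)
    (hyz : y ≤ z) : ({k, l, m} : Multiset ℕ) = {x, y, z} ↔ k = x ∧ l = y ∧ m = z := by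
  constructor
  · intro h
    have h' : [k, l, m].Perm [x, y, z] := Multiset.coe_eq_coe.1 h
    have hs := h'.eq_of_pairwise (le := (· ≤ ·)) (fun a b _ _ => le_antisymm)
      (by simp; omega) (by simp; omega)
    simpa using hs
  · rintro ⟨rfl, rfl, rfl⟩
    rfl

/-- The multisets of path lengths of the cubic theta graphs that are not edge-reflexive. -/
def Exceptional (s : Multiset ℕ) : Prop :=
  (∃ n : ℕ, 2 ≤ n ∧ s = {1, 1, n}) ∨ (∃ n : ℕ, 1 ≤ n ∧ s = {1, 2, n}) ∨ s = {2, 2, 2} ∨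
    s = {2, 2, 3} ∨ s = {2, 2, 4} ∨ s = {2, 3, 3} ∨ s = {2, 3, 4} ∨ s = {3, 3, 3}

theorem exceptional_iff_not_good {k l m : ℕ} (hk : 1 ≤ k) (hkl : k ≤ l) (hlm : l ≤ m) :
    Exceptional {k, l, m} ↔ ¬ Good k l m := by
  have h1 : (∃ n : ℕ, 2 ≤ n ∧ ({k, l, m} : Multiset ℕ) = {1, 1, n}) ↔ k = 1 ∧ l = 1 ∧ 2 ≤ m := by
    constructor
    · rintro ⟨n, hn, h⟩
      rw [multiset_triple_eq_iff hkl hlm (by omega) (by omega)] at h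
      omega
    · rintro ⟨rfl, rfl, hm⟩
      exact ⟨m, hm, rfl⟩
  have h2 : (∃ n : ℕ, 1 ≤ n ∧ ({k, l, m} : Multiset ℕ) = {1, 2, n}) ↔
      k = 1 ∧ l = 1 ∧ m = 2 ∨ k = 1 ∧ l = 2 := by
    constructor
    · rintro ⟨n, hn, h⟩
      rcases hn.eq_or_lt with rfl | hn
      · rw [Multiset.pair_comm 2 1,
          multiset_triple_eq_iff hkl hlm (by omega) (by omega)] at h
        omega
      · rw [multiset_triple_eq_iff hkl hlm (by omega) (by omega)] at h
        omega
    · rintro (⟨rfl, rfl, rfl⟩ | ⟨rfl, rfl⟩)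
      · exact ⟨1, le_rfl, by rw [Multiset.pair_comm 2 1]⟩
      · exact ⟨m, by omega, rfl⟩
  unfold Exceptional Good
  rw [h1, h2, multiset_triple_eq_iff hkl hlm (by omega) (by omega),
    multiset_triple_eq_iff hkl hlm (by omega) (by omega),
    multiset_triple_eq_iff hkl hlm (by omega) (by omega),
    multiset_triple_eq_iff hkl hlm (by omega) (by omega),
    multiset_triple_eq_iff hkl hlm (by omega) (by omega),
    multiset_triple_eq_iff hkl hlm (by omega) (by omega)]
  rcases Nat.lt_or_ge k 4 with hk4 | hk4
  · interval_cases k <;> simp <;> omega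
  · simp [show k ≠ 1 by omega, show k ≠ 2 by omega, show k ≠ 3 by omega, hk4]

theorem not_reflexive_iff_exceptional {k l m : ℕ} (hk : 1 ≤ k) (hl : 1 ≤ l) (hm : 1 ≤ m) :
    ¬ Reflexive k l m ↔ Exceptional {k, l, m} := by
  have sorted : ∀ {k l m : ℕ}, 1 ≤ k → k ≤ l → l ≤ m →
      (¬ Reflexive k l m ↔ Exceptional {k, l, m}) := fun hk hkl hlm => by
    rw [reflexive_iff_good hk hkl hlm, exceptional_iff_not_good hk hkl hlm]
  have left : ∀ {k l m : ℕ}, (¬ Reflexive k l m ↔ Exceptional {k, l, m}) →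
      (¬ Reflexive l k m ↔ Exceptional {l, k, m}) := fun {k l m} h => by
    rw [show ({l, k, m} : Multiset ℕ) = {k, l, m} from Multiset.cons_swap l k {m}, ← h]
    exact not_congr ⟨Reflexive.swap_left, Reflexive.swap_left⟩
  have right : ∀ {k l m : ℕ}, (¬ Reflexive k l m ↔ Exceptional {k, l, m}) →
      (¬ Reflexive k m l ↔ Exceptional {k, m, l}) := fun {k l m} h => by
    rw [Multiset.pair_comm m l, ← h]
    exact not_congr ⟨Reflexive.swap_right, Reflexive.swap_right⟩
  rcases le_total k l with h1 | h1 <;> rcases le_total l m with h2 | h2 <;>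
    rcases le_total k m with h3 | h3
  · exact sorted hk h1 h2
  · exact sorted hk h1 h2
  · exact right (sorted hk h3 h2)
  · exact right (left (sorted hm h3 h1))
  · exact left (sorted hl h1 h3)
  · exact left (right (sorted hl h2 h3))
  · exact left (right (left (sorted hm h2 h1)))
  · exact left (right (left (sorted hm h2 h1)))

end CubicTheta

theorem theorem4p3 (k l m : ℕ) (hk : 1 ≤ k) (hl : 1 ≤ l) (hm : 1 ≤ m) :
    ¬ (thetaGraph k l m).EdgeReflexive ↔
      (∃ n : ℕ, 2 ≤ n ∧ ({k, l, m} : Multiset ℕ) = {1, 1, n}) ∨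
      (∃ n : ℕ, 1 ≤ n ∧ ({k, l, m} : Multiset ℕ) = {1, 2, n}) ∨
      ({k, l, m} : Multiset ℕ) = {2, 2, 2} ∨
      ({k, l, m} : Multiset ℕ) = {2, 2, 3} ∨
      ({k, l, m} : Multiset ℕ) = {2, 2, 4} ∨
      ({k, l, m} : Multiset ℕ) = {2, 3, 3} ∨
      ({k, l, m} : Multiset ℕ) = {2, 3, 4} ∨
      ({k, l, m} : Multiset ℕ) = {3, 3, 3} := by
  rw [CubicTheta.thetaGraph_edgeReflexive_iff hk hl hm]
  exact CubicTheta.not_reflexive_iff_exceptional hk hl hm
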